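/- Let $K$ be a (commutative) field, $\theta : K \to K$ a ring homomorphism and $\delta : K \to K$ a $\theta$-derivation, i.e. an additive map with $\delta(ab) = \theta(a)\delta(b) + \delta(a)b$. Assume $(\theta,\delta) \ne (\mathrm{id}_K, 0)$ and that $K$ is a finite extension of its subfield $F = \{a \in K : \theta(a) = a,\ \delta(a) = 0\}$; put $s = [K:F]$. If $\theta \neq \mathrm{id}_K$, let $a \in K$ be the unique element with $\delta = a(\theta - \mathrm{id}_K)$. Let $\mathcal A^+ = K[X;\theta,\delta]$ be the ring of Ore polynomials ($Xb = \theta(b)X + \delta(b)$ for $b\in K$), $\mathcal A^+_{<k}$ its subspace of elements of degree $<k$, and $\mathcal A$ its skew field of fractions. Let $Z = Z(X) \in \mathcal A^+$ be the monic polynomial of least degree with $Z(\delta) = 0$ if $\theta = \mathrm{id}_K$, and $Z = (X+a)^s$ if $\theta \ne \mathrm{id}_K$; it is central. For $c \in K$ let $\mathrm{ev}_c : \mathcal A^+ \to \mathrm{End}_F(K)$ be the ring homomorphism $P \mapsto P(\delta + c\theta)$ and let $\upsilon(c)$ be the remainder of the right Euclidean division of $Z$ by $X - c$. The element $c$ is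 unramified if $\delta + c\theta$ is not a scalar multiple of $\mathrm{id}_K$. Then $\mathrm{ev}_c$ factors through $\mathcal A^+/(Z-\upsilon(c))\mathcal A^+$, and the induced map is again denoted by $\mathrm{ev}_c$. Let $z = \upsilon(c)$ with $c$ unramified and $N_z = Z - z$. A $z$-admissible isomorphism is an isomorphism of $K$-algebras $\varprojlim_{r>0} \mathcal A^+/N_z^r\mathcal A^+ \to (\mathcal A^+/N_z\mathcal A^+)[[T]]$ that maps $N_z$ to $T$ and induces the identity modulo $N_z$ on the left and $T$ on the right. A Taylor expansion at $z$ is a ring homomorphism $\mathrm{TS}_z : \mathcal A \to (\mathcal A^+/N_z\mathcal A^+)((T))$ that extends the map $\mathcal A^+ \to (\mathcal A^+/N_z\mathcal A^+)[[T]]$ given by such an isomorphism. The skew residue $\mathrm{sres}_z(f)$ is the coefficient of $T^{-1}$ in $\mathrm{TS}_z(f)$. An $f \in \mathcal A$ has no pole at $z$ if $\mathrm{TS}_z(f)$ has no term of negative degree; then its evaluation $\mathrm{ev}_c(f)$ is $\mathrm{ev}_c$ of the constant coefficient of $\mathrm{TS}_z(f)$. Let $m \ge 1$, let $c = (c_1,\dots,c_m)$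 be unramified elements of $K$ such that the $z_i = \upsilon(c_i)$ are pairwise distinct, and let $V = (V_1,\dots,V_m)$ be $F$-subspaces of $K$. Put $N_i = Z - z_i$, $N = \prod_i N_i$, $n = \sum_i \dim_F K/V_i$, and let $k$ be an integer with $0 < k < n$. Let $D' \in \mathcal A^+$ be the monic polynomial of degree $\sum_i \dim_F V_i$ such that $\mathrm{ev}_{c_i}(D')$ vanishes on $V_i$ for all $i$, and let $D$ be defined by $D'D = DD' = N$. Let $$P = D^{-1} \ \text{ if } \theta = \mathrm{id}_K, \qquad P = Z^{-m-1}(X+a)^{n-k}D^{-1} \ \text{ if } \theta \ne \mathrm{id}_K.$$ For $F$-subspaces $W_1,\dots,W_m$ of $K$, the linearized Reed-Solomon code $\mathrm{LRS}(k,c,W) \subseteq \prod_i \mathrm{Hom}_F(W_i,K)$ is the image of $\mathcal A^+_{<k}$ under $Q \mapsto (\mathrm{ev}_{c_i}(Q)|_{W_i})_i$. The linearized Goppa code $\mathrm{LG}(k,c,V) \subseteq \prod_i \mathrm{Hom}_F(K/V_i,K)$ is the image of $\mathcal A^+_{<k}\cdot P$ under $f \mapsto (\mathrm{ev}_{c_i}(\mathrm{sres}_{z_i}(f)))_i$.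 The sum-rank weight of $(\varphi_i)_i$ is $\sum_i \dim_F \mathrm{im}\,\varphi_i$, and the sum-rank distance of two tuples is the weight of their difference. **Theorem.** Taylor expansions at every $z_i$ exist, and $D$ as above exists and is unique. For every choice of Taylor expansions at the $z_i$, the following holds. 1. For every $i$, $PN_i$ has no pole at $z_i$, and $\tilde\tau_i = \mathrm{ev}_{c_i}(PN_i) \in \mathrm{End}_F(K)$ has kernel $V_i$. Hence it induces an isomorphism $\tau_i : K/V_i \to W_i$, where $W_i = \mathrm{im}\,\tilde\tau_i$. 2. For every $f \in \mathcal A^+_{<k} P$ and every $i$, $\mathrm{ev}_{c_i}(\mathrm{sres}_{z_i}(f))$ vanishes on $V_i$, so that $\mathrm{LG}(k,c,V)$ is well defined. Neither $\mathrm{LG}(k,c,V)$ nor the $\tilde\tau_i$ depend on the choice of the Taylor expansions. 3. The $K$-linear map $$\Psi : \prod_i \mathrm{Hom}_F(W_i,K) \to \prod_i \mathrm{Hom}_F(K/V_i,K), \qquad (\varphi_i)_i \mapsto (\varphi_i\circ\tau_i)_i$$ is bijective, preserves the sum-rank weight and the sum-rank distance, and maps $\mathrm{LRS}(k,c,W)$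 onto $\mathrm{LG}(k,c,V)$, where $W = (W_1,\dots,W_m)$. -/

import Mathlib

/-- A `θ`-derivation of `K`: an additive map with `δ (a b) = θ a * δ b + δ a * b`. -/
structure SkewDerivation {K : Type*} [Field K] (θ : K →+* K) extends K →+ K where
  leibniz' : ∀ a b : K, toFun (a * b) = θ a * toFun b + toFun a * b

namespace SkewDerivation

variable {K : Type*} [Field K] {θ : K →+* K}

instance : CoeFun (SkewDerivation θ) (fun _ => K → K) := ⟨fun δ => δ.toAddMonoidHom⟩

theorem leibniz (δ : SkewDerivation θ) (a b : K) : δ (a * b) = θ a * δ b + δ a * b :=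
  δ.leibniz' a b

theorem map_one_eq (δ : SkewDerivation θ) : δ 1 = 0 := by
  have h := δ.leibniz 1 1
  simpa using h

/-- The subfield `F` of the `a ∈ K` with `θ a = a` and `δ a = 0`. -/
def constants (δ : SkewDerivation θ) : Subfield K where
  carrier := {a | θ a = a ∧ δ a = 0}
  mul_mem' := by
    rintro a b ⟨ha, ha'⟩ ⟨hb, hb'⟩
    exact ⟨by rw [map_mul, ha, hb], by rw [δ.leibniz, ha', hb']; simp⟩
  one_mem' := ⟨map_one θ, δ.map_one_eq⟩
  add_mem' := by
    rintro a b ⟨ha, ha'⟩ ⟨hb, hb'⟩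
    exact ⟨by rw [map_add, ha, hb], by rw [map_add, ha', hb', add_zero]⟩
  zero_mem' := ⟨map_zero θ, map_zero _⟩
  neg_mem' := by
    rintro a ⟨ha, ha'⟩
    exact ⟨by rw [map_neg, ha], by rw [map_neg, ha', neg_zero]⟩
  inv_mem' := by
    rintro a ⟨ha, ha'⟩
    refine ⟨by rw [map_inv₀, ha], ?_⟩
    by_cases h0 : a = 0
    · subst h0; simp
    · have h := δ.leibniz a a⁻¹
      rw [mul_inv_cancel₀ h0, δ.map_one_eq, ha', zero_mul, add_zero, ha] at h
      exact (mul_eq_zero.mp h.symm).resolve_left h0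

theorem mem_constants {δ : SkewDerivation θ} {a : K} :
    a ∈ δ.constants ↔ θ a = a ∧ δ a = 0 := Iff.rfl

end SkewDerivation

/-- The Ore polynomials `K[X; θ, δ]`. The underlying left `K`-vector space is that of the
polynomials `∑ aᵢ Xⁱ`; the multiplication is the twisted one defined below. -/
def OrePoly {K : Type*} [Field K] {θ : K →+* K} (_δ : SkewDerivation θ) : Type _ := Polynomial K

namespace OrePoly

variable {K : Type*} [Field K] {θ : K →+* K} {δ : SkewDerivation θ}

noncomputable instance : AddCommGroup (OrePoly δ) := inferInstanceAs (AddCommGroup (Polynomial K))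

noncomputable instance : Module K (OrePoly δ) := inferInstanceAs (Module K (Polynomial K))

/-- The coefficient of `Xⁿ`. -/
noncomputable def coeff (p : OrePoly δ) (n : ℕ) : K := Polynomial.coeff (show Polynomial K from p) n

/-- The degree, with value `⊥` at `0`. -/
noncomputable def degree (p : OrePoly δ) : WithBot ℕ := Polynomial.degree (show Polynomial K from p)

/-- Leading coefficient equal to `1`. -/
def Monic (p : OrePoly δ) : Prop := Polynomial.Monic (show Polynomial K from p)

/-- `a Xⁿ`. -/
noncomputable def monomial (n : ℕ) (a : K) : OrePoly δ :=
  (show OrePoly δ from Polynomial.monomial n a)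

theorem ext_coeff {p q : OrePoly δ} (h : ∀ n, p.coeff n = q.coeff n) : p = q :=
  Polynomial.ext h

theorem coeff_add (p q : OrePoly δ) (n : ℕ) : (p + q).coeff n = p.coeff n + q.coeff n :=
  Polynomial.coeff_add _ _ _

theorem coeff_smul (a : K) (p : OrePoly δ) (n : ℕ) : (a • p).coeff n = a * p.coeff n :=
  Polynomial.coeff_smul _ _ _

theorem coeff_monomial (i n : ℕ) (a : K) :
    (monomial i a : OrePoly δ).coeff n = if i = n then a else 0 :=
  Polynomial.coeff_monomial

theorem monomial_add (n : ℕ) (a b : K) :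
    (monomial n (a + b) : OrePoly δ) = monomial n a + monomial n b :=
  (Polynomial.monomial n).map_add a b

theorem monomial_zero (n : ℕ) : (monomial n 0 : OrePoly δ) = 0 :=
  Polynomial.monomial_zero_right n

theorem smul_monomial (n : ℕ) (a b : K) :
    a • (monomial n b : OrePoly δ) = monomial n (a * b) :=
  Polynomial.smul_monomial a n b

theorem induction {M : OrePoly δ → Prop} (p : OrePoly δ)
    (hadd : ∀ p q, M p → M q → M (p + q)) (hmon : ∀ n a, M (monomial n a)) : M p :=
  Polynomial.induction_on' p hadd hmon

section Action

variable {R M : Type*} [CommSemiring R] [AddCommGroup M] [Module K M] [Module R M]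
  [SMulCommClass R K M]

/-- For `P = ∑ aᵢ Xⁱ` and an endomorphism `u` of a `K`-vector space, `P(u) = ∑ aᵢ uⁱ`. -/
noncomputable def evalEnd (u : Module.End R M) (p : OrePoly δ) : Module.End R M :=
  Polynomial.sum (show Polynomial K from p) fun i a => a • u ^ i

theorem evalEnd_add (u : Module.End R M) (p q : OrePoly δ) :
    evalEnd u (p + q) = evalEnd u p + evalEnd u q :=
  Polynomial.sum_add_index _ _ _ (fun _ => zero_smul _ _) (fun _ _ _ => add_smul _ _ _)

theorem evalEnd_monomial (u : Module.End R M) (n : ℕ) (a : K) :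
    evalEnd u (monomial n a : OrePoly δ) = a • u ^ n :=
  Polynomial.sum_monomial_index _ _ (zero_smul _ _)

theorem evalEnd_zero (u : Module.End R M) : evalEnd u (0 : OrePoly δ) = 0 := by
  rw [← monomial_zero 0, evalEnd_monomial, zero_smul]

theorem evalEnd_smul (u : Module.End R M) (a : K) (p : OrePoly δ) :
    evalEnd u (a • p) = a • evalEnd u p := by
  induction p using OrePoly.induction with
  | hadd p q hp hq => rw [smul_add, evalEnd_add, evalEnd_add, hp, hq, smul_add]
  | hmon n b => rw [smul_monomial, evalEnd_monomial, evalEnd_monomial, mul_smul]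

end Action

/-- Left multiplication by `X`, that is `∑ aᵢ Xⁱ ↦ ∑ (θ aᵢ Xⁱ⁺¹ + δ aᵢ Xⁱ)`. -/
noncomputable def mulX (δ : SkewDerivation θ) : Module.End ℤ (OrePoly δ) :=
  AddMonoidHom.toIntLinearMap
    { toFun := fun q => Polynomial.sum (show Polynomial K from q) fun i a =>
        (monomial (i + 1) (θ a) + monomial i (δ a) : OrePoly δ)
      map_zero' := Polynomial.sum_zero_index _
      map_add' := fun p q => Polynomial.sum_add_index (show Polynomial K from p)
        (show Polynomial K from q) _
        (fun i => by rw [map_zero, map_zero, monomial_zero, monomial_zero, add_zero])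
        (fun i a b => by rw [map_add, map_add, monomial_add, monomial_add]; abel) }

theorem mulX_monomial (n : ℕ) (a : K) :
    mulX δ (monomial n a) = monomial (n + 1) (θ a) + monomial n (δ a) :=
  Polynomial.sum_monomial_index a
    (fun i a => (monomial (i + 1) (θ a) + monomial i (δ a) : OrePoly δ)) (by rw [map_zero, map_zero, monomial_zero, monomial_zero, add_zero])

theorem mulX_smul (a : K) (q : OrePoly δ) :
    mulX δ (a • q) = θ a • mulX δ q + δ a • q := by
  induction q using OrePoly.induction with
  | hadd p q hp hq => rw [smul_add, map_add, hp, hq, map_add, smul_add, smul_add]; abel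
  | hmon n b =>
    rw [smul_monomial, mulX_monomial, mulX_monomial, smul_add, smul_monomial, smul_monomial,
      smul_monomial, map_mul, δ.leibniz, monomial_add, add_assoc]

/-- The product of `P = ∑ aᵢ Xⁱ` and `Q` is `∑ aᵢ (Xⁱ Q)`. -/
noncomputable instance : Mul (OrePoly δ) := ⟨fun p q => evalEnd (mulX δ) p q⟩

noncomputable instance : One (OrePoly δ) := ⟨monomial 0 1⟩

theorem mul_def (p q : OrePoly δ) : p * q = evalEnd (mulX δ) p q := rfl

theorem one_def : (1 : OrePoly δ) = monomial 0 1 := rfl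

theorem evalEnd_one {R M : Type*} [CommSemiring R] [AddCommGroup M] [Module K M] [Module R M]
    [SMulCommClass R K M] (u : Module.End R M) :
    evalEnd u (1 : OrePoly δ) = 1 := by
  rw [one_def, evalEnd_monomial, one_smul, pow_zero]

/-- If `u` is pseudo-linear then `(P Q)(u) = P(u) ∘ Q(u)`. -/
theorem evalEnd_mul {R M : Type*} [CommSemiring R] [AddCommGroup M] [Module K M] [Module R M]
    [SMulCommClass R K M] (u : Module.End R M)
    (hu : ∀ (a : K) (x : M), u (a • x) = θ a • u x + δ a • x) (p q : OrePoly δ) :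
    evalEnd u (p * q) = evalEnd u p * evalEnd u q := by
  have hX : ∀ q : OrePoly δ, evalEnd u (mulX δ q) = u * evalEnd u q := by
    intro q
    induction q using OrePoly.induction with
    | hadd p q hp hq => rw [map_add, evalEnd_add, hp, hq, evalEnd_add, mul_add]
    | hmon n b =>
      ext x
      rw [mulX_monomial, evalEnd_add, evalEnd_monomial, evalEnd_monomial, evalEnd_monomial]
      simp [hu, pow_succ']
  have hXn : ∀ (n : ℕ) (q : OrePoly δ), evalEnd u ((mulX δ ^ n) q) = u ^ n * evalEnd u q := by
    intro n
    induction n with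
    | zero => intro q; simp
    | succ n ih => intro q; rw [pow_succ', Module.End.mul_apply, hX, ih, pow_succ', mul_assoc]
  rw [mul_def]
  induction p using OrePoly.induction with
  | hadd p p' hp hp' =>
    rw [evalEnd_add, LinearMap.add_apply, evalEnd_add, hp, hp', evalEnd_add, add_mul]
  | hmon n b =>
    rw [evalEnd_monomial, LinearMap.smul_apply, evalEnd_smul, hXn, evalEnd_monomial, smul_mul_assoc]

theorem mulX_pow_one (n : ℕ) : (mulX δ ^ n) (1 : OrePoly δ) = monomial n 1 := by
  induction n with
  | zero => rfl
  | succ n ih =>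
    rw [pow_succ', Module.End.mul_apply, ih, mulX_monomial, map_one, δ.map_one_eq, monomial_zero,
      add_zero]

noncomputable instance : Ring (OrePoly δ) where
  left_distrib p q r := map_add _ _ _
  right_distrib p q r := by rw [mul_def, evalEnd_add]; rfl
  zero_mul p := by rw [mul_def, evalEnd_zero]; rfl
  mul_zero p := map_zero _
  mul_assoc p q r := by
    rw [mul_def (p * q) r, evalEnd_mul (mulX δ) mulX_smul]; rfl
  one_mul p := by rw [mul_def, evalEnd_one]; rfl
  mul_one p := by
    induction p using OrePoly.induction with
    | hadd p q hp hq =>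
      rw [mul_def] at hp hq ⊢
      rw [evalEnd_add, LinearMap.add_apply, hp, hq]
    | hmon n a =>
      rw [mul_def, evalEnd_monomial, LinearMap.smul_apply, mulX_pow_one, smul_monomial, mul_one]
  zsmul := fun n p => n • p
  zsmul_zero' p := zero_smul ℤ p
  zsmul_succ' n p := SubNegMonoid.zsmul_succ' n p
  zsmul_neg' n p := SubNegMonoid.zsmul_neg' n p
  neg_add_cancel := neg_add_cancel
  sub_eq_add_neg := sub_eq_add_neg
  nsmul := fun n p => n • p
  nsmul_zero p := zero_smul ℕ p
  nsmul_succ n p := AddMonoid.nsmul_succ n p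

/-- The inclusion of `K` as constant Ore polynomials. -/
noncomputable def C : K →+* OrePoly δ where
  toFun a := monomial 0 a
  map_one' := rfl
  map_zero' := monomial_zero 0
  map_add' := monomial_add 0
  map_mul' a b := by
    rw [mul_def, evalEnd_monomial, LinearMap.smul_apply, pow_zero, Module.End.one_apply,
      smul_monomial]

/-- The variable `X`. -/
noncomputable def X : OrePoly δ := monomial 1 1

theorem C_mul (a : K) (p : OrePoly δ) : C a * p = a • p := by
  change monomial 0 a * p = _
  rw [mul_def, evalEnd_monomial, LinearMap.smul_apply, pow_zero, Module.End.one_apply]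

theorem X_mul (p : OrePoly δ) : X * p = mulX δ p := by
  rw [X, mul_def, evalEnd_monomial, LinearMap.smul_apply, pow_one, one_smul]

/-- The defining rule of the multiplication. -/
theorem X_mul_C (a : K) : (X : OrePoly δ) * C a = C (θ a) * X + C (δ a) := by
  rw [X_mul, C_mul, X, smul_monomial, mul_one]
  exact mulX_monomial 0 a

theorem monomial_eq (n : ℕ) (a : K) : (monomial n a : OrePoly δ) = C a * X ^ n := by
  have h : ∀ n : ℕ, (X : OrePoly δ) ^ n = monomial n 1 := by
    intro n
    induction n with
    | zero => rfl
    | succ n ih =>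
      rw [pow_succ', ih, X_mul, mulX_monomial, map_one, δ.map_one_eq, monomial_zero, add_zero]
  rw [h, C_mul, smul_monomial, mul_one]

end OrePoly

namespace OrePoly

variable {K : Type*} [Field K] {θ : K →+* K} {δ : SkewDerivation θ}

theorem coeff_mulX_succ (p : OrePoly δ) (n : ℕ) :
    (mulX δ p).coeff (n + 1) = θ (p.coeff n) + δ (p.coeff (n + 1)) := by
  induction p using OrePoly.induction with
  | hadd p q hp hq => simp only [map_add, coeff_add, hp, hq]; abel
  | hmon i a =>
    simp only [mulX_monomial, coeff_add, coeff_monomial, Nat.add_right_cancel_iff]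
    split_ifs <;> simp

theorem degree_lt_iff {p : OrePoly δ} {n : ℕ} : p.degree < n ↔ ∀ i, n ≤ i → p.coeff i = 0 :=
  Polynomial.degree_lt_iff_coeff_zero _ _

/-- Degree at most `n` with coefficient `a` of `Xⁿ`. -/
theorem mulX_top {p : OrePoly δ} {n : ℕ} (hp : ∀ i, n < i → p.coeff i = 0) :
    (mulX δ p).coeff (n + 1) = θ (p.coeff n) ∧ ∀ i, n + 1 < i → (mulX δ p).coeff i = 0 := by
  refine ⟨by rw [coeff_mulX_succ, hp _ (Nat.lt_succ_self n), map_zero, add_zero], fun i hi => ?_⟩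
  obtain ⟨j, rfl⟩ : ∃ j, i = j + 1 := ⟨i - 1, by omega⟩
  rw [coeff_mulX_succ, hp j (by omega), hp (j + 1) (by omega), map_zero, map_zero, add_zero]

theorem mulX_pow_top {p : OrePoly δ} {n : ℕ} (hp : ∀ i, n < i → p.coeff i = 0) (e : ℕ) :
    ((mulX δ ^ e) p).coeff (n + e) = (θ^[e]) (p.coeff n) ∧
      ∀ i, n + e < i → ((mulX δ ^ e) p).coeff i = 0 := by
  induction e with
  | zero => exact ⟨rfl, hp⟩
  | succ e ih =>
    rw [pow_succ', Module.End.mul_apply, Function.iterate_succ_apply', ← ih.1]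
    exact mulX_top ih.2

theorem monomial_mul (e : ℕ) (b : K) (p : OrePoly δ) :
    monomial e b * p = b • (mulX δ ^ e) p := by
  rw [mul_def, evalEnd_monomial, LinearMap.smul_apply]

theorem exists_top {p : OrePoly δ} (hp : p ≠ 0) :
    ∃ n, p.coeff n ≠ 0 ∧ ∀ i, n < i → p.coeff i = 0 :=
  ⟨Polynomial.natDegree (show Polynomial K from p), Polynomial.leadingCoeff_ne_zero.mpr hp,
    fun _ hi => Polynomial.coeff_eq_zero_of_natDegree_lt hi⟩

theorem exists_split {p : OrePoly δ} {n : ℕ} (hp : ∀ i, n < i → p.coeff i = 0) :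
    ∃ q : OrePoly δ, p = q + monomial n (p.coeff n) ∧ ∀ i, n ≤ i → q.coeff i = 0 := by
  refine ⟨p + monomial n (-p.coeff n), ?_, fun i hi => ?_⟩
  · rw [add_assoc, ← monomial_add, neg_add_cancel, monomial_zero, add_zero]
  · rw [coeff_add, coeff_monomial]
    rcases hi.eq_or_lt with rfl | h
    · rw [if_pos rfl, add_neg_cancel]
    · rw [if_neg h.ne, hp i h, add_zero]

theorem coeff_zero (n : ℕ) : (0 : OrePoly δ).coeff n = 0 := Polynomial.coeff_zero n

theorem mul_top {q : OrePoly δ} {n : ℕ} (hq : ∀ i, n < i → q.coeff i = 0) (k : ℕ) :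
    ∀ p : OrePoly δ, (∀ i, k < i → p.coeff i = 0) →
    (p * q).coeff (n + k) = p.coeff k * (θ^[k]) (q.coeff n) ∧
      ∀ i, n + k < i → (p * q).coeff i = 0 := by
  have key : ∀ k : ℕ, ∀ p : OrePoly δ, (∀ i, k ≤ i → p.coeff i = 0) →
      ∀ i, n + k ≤ i → (p * q).coeff i = 0 := by
    intro k
    induction k with
    | zero =>
      intro p hp i _
      rw [show p = 0 from ext_coeff fun i => by rw [hp i (Nat.zero_le i), coeff_zero], zero_mul,
        coeff_zero]
    | succ k ih =>
      intro p hp i hi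
      obtain ⟨r, hr, hr'⟩ := exists_split (p := p) (n := k) (fun i hi => hp i hi)
      rw [hr, add_mul, coeff_add, ih r hr' i (by omega), monomial_mul, coeff_smul,
        (mulX_pow_top hq k).2 i (by omega), mul_zero, add_zero]
  intro p hp
  obtain ⟨r, hr, hr'⟩ := exists_split hp
  have h1 : ∀ i, (p * q).coeff i = (r * q).coeff i + p.coeff k * ((mulX δ ^ k) q).coeff i := by
    intro i
    conv_lhs => rw [hr]
    rw [add_mul, coeff_add, monomial_mul, coeff_smul]
  refine ⟨?_, fun i hi => ?_⟩
  · rw [h1, key k r hr' _ le_rfl, zero_add, (mulX_pow_top hq k).1]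
  · rw [h1, key k r hr' _ hi.le, (mulX_pow_top hq k).2 i hi, mul_zero, add_zero]

theorem iterate_ne_zero {a : K} (ha : a ≠ 0) (e : ℕ) : (θ^[e]) a ≠ 0 := by
  induction e with
  | zero => exact ha
  | succ e ih => rw [Function.iterate_succ_apply']; exact (map_ne_zero θ).mpr ih

instance : Nontrivial (OrePoly δ) := inferInstanceAs (Nontrivial (Polynomial K))

instance : NoZeroDivisors (OrePoly δ) where
  eq_zero_or_eq_zero_of_mul_eq_zero := by
    intro p q h
    by_contra hne
    rw [not_or] at hne
    obtain ⟨k, hk, hk'⟩ := exists_top hne.1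
    obtain ⟨n, hn, hn'⟩ := exists_top hne.2
    have := (mul_top hn' k p hk').1
    rw [h, coeff_zero] at this
    exact mul_ne_zero hk (iterate_ne_zero hn k) this.symm

/-- Right Euclidean division: `A = Q B + R` with `deg R < deg B`. -/
theorem exists_rightDiv (A : OrePoly δ) {B : OrePoly δ} (hB : B ≠ 0) :
    ∃ R : OrePoly δ, R.degree < B.degree ∧ ∃ Q, A = Q * B + R := by
  obtain ⟨n, hn, hn'⟩ := exists_top hB
  have hdeg : ∀ R : OrePoly δ, (∀ i, n ≤ i → R.coeff i = 0) → R.degree < B.degree := fun R hR =>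
    lt_of_lt_of_le (degree_lt_iff.mpr hR) (Polynomial.le_degree_of_ne_zero hn)
  suffices h : ∀ k : ℕ, ∀ A : OrePoly δ, (∀ i, k ≤ i → A.coeff i = 0) →
      ∃ R : OrePoly δ, R.degree < B.degree ∧ ∃ Q, A = Q * B + R by
    by_cases hA : A = 0
    · exact h 0 A (fun i _ => by rw [hA, coeff_zero])
    · obtain ⟨k, -, hk⟩ := exists_top hA
      exact h (k + 1) A (fun i hi => hk i hi)
  intro k
  induction k with
  | zero =>
    intro A hA
    exact ⟨A, hdeg A (fun i _ => hA i (Nat.zero_le i)), 0, by rw [zero_mul, zero_add]⟩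
  | succ k ih =>
    intro A hA
    by_cases hkn : k < n
    · exact ⟨A, hdeg A (fun i hi => hA i (by omega)), 0, by rw [zero_mul, zero_add]⟩
    · obtain ⟨e, rfl⟩ : ∃ e, k = n + e := ⟨k - n, by omega⟩
      set b : K := A.coeff (n + e) / (θ^[e]) (B.coeff n) with hb
      obtain ⟨R, hR, Q, hQ⟩ := ih (A - monomial e b * B) (by
        intro i hi
        have h1 : (A - monomial e b * B).coeff i
            = A.coeff i - b * ((mulX δ ^ e) B).coeff i := by
          rw [monomial_mul, ← coeff_smul]; exact Polynomial.coeff_sub _ _ _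
        rcases hi.eq_or_lt with rfl | hi'
        · rw [h1, (mulX_pow_top hn' e).1, hb, div_mul_cancel₀ _ (iterate_ne_zero hn e), sub_self]
        · rw [h1, (mulX_pow_top hn' e).2 i hi', hA i hi', mul_zero, sub_zero])
      exact ⟨R, hR, Q + monomial e b, by rw [add_mul, add_right_comm, ← hQ, sub_add_cancel]⟩

/-- The remainder `A % B` of the right Euclidean division of `A` by `B`. -/
noncomputable def rightRem (A B : OrePoly δ) : OrePoly δ :=
  open scoped Classical in if hB : B = 0 then A else (exists_rightDiv A hB).choose

theorem rightRem_spec (A : OrePoly δ) {B : OrePoly δ} (hB : B ≠ 0) :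
    (rightRem A B).degree < B.degree ∧ ∃ Q, A = Q * B + rightRem A B := by
  rw [rightRem, dif_neg hB]
  exact (exists_rightDiv A hB).choose_spec

theorem ore_condition (r : OrePoly δ) {s : OrePoly δ} (hs : s ≠ 0) :
    ∃ r' s' : OrePoly δ, s' ≠ 0 ∧ s' * r = r' * s := by
  have wf : WellFounded fun p q : OrePoly δ => p.degree < q.degree :=
    InvImage.wf (fun p : OrePoly δ => p.degree) wellFounded_lt
  induction s using wf.induction generalizing r with
  | _ s ih =>
    obtain ⟨r₁, hlt, q, hq⟩ := exists_rightDiv r hs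
    by_cases h0 : r₁ = 0
    · exact ⟨q, 1, one_ne_zero, by rw [one_mul, hq, h0, add_zero]⟩
    · obtain ⟨t', t, ht, htt⟩ := ih r₁ hlt s h0
      refine ⟨t' * q + t, t', ?_, ?_⟩
      · rintro rfl
        rw [zero_mul] at htt
        exact (mul_ne_zero ht hs) htt
      · rw [hq, mul_add, ← htt, add_mul, mul_assoc]

open scoped nonZeroDivisors in
noncomputable instance : OreLocalization.OreSet (OrePoly δ)⁰ :=
  (OreLocalization.nonempty_oreSet_iff_of_noZeroDivisors.mpr fun r s => by
    obtain ⟨r', s', hs', h⟩ := ore_condition r (nonZeroDivisors.ne_zero s.2)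
    exact ⟨r', ⟨s', mem_nonZeroDivisors_of_ne_zero hs'⟩, h⟩).some

end OrePoly

namespace OrePoly

open Module

variable {K : Type*} [Field K] {θ : K →+* K} {δ : SkewDerivation θ}

/-- The pseudo-linear endomorphism `δ + c θ` of `K`. -/
def pseudoEnd (δ : SkewDerivation θ) (c : K) : Module.End δ.constants K where
  toFun x := δ x + c * θ x
  map_add' x y := by rw [map_add, map_add, mul_add]; abel
  map_smul' a x := by
    have h := a.2
    rw [SkewDerivation.mem_constants] at h
    simp only [Subfield.smul_def, smul_eq_mul, RingHom.id_apply]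
    rw [δ.leibniz, map_mul, h.1, h.2]
    ring

theorem pseudoEnd_apply (c x : K) : pseudoEnd δ c x = δ x + c * θ x := rfl

theorem pseudoEnd_smul (c a x : K) :
    pseudoEnd δ c (a • x) = θ a • pseudoEnd δ c x + δ a • x := by
  simp only [pseudoEnd_apply, smul_eq_mul, δ.leibniz, map_mul]
  ring

/-- The evaluation map `ev_c : P ↦ P(δ + c θ)`. -/
noncomputable def ev (δ : SkewDerivation θ) (c : K) : OrePoly δ →+* Module.End δ.constants K where
  toFun := evalEnd (pseudoEnd δ c)
  map_one' := evalEnd_one _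
  map_zero' := evalEnd_zero _
  map_add' := evalEnd_add _
  map_mul' := evalEnd_mul _ (pseudoEnd_smul c)

theorem ev_smul (c a : K) (p : OrePoly δ) : ev δ c (a • p) = a • ev δ c p :=
  evalEnd_smul _ _ _

theorem ev_C (c a x : K) : ev δ c (C a) x = a * x := by
  have h : ev δ c (C a) = a • (pseudoEnd δ c) ^ 0 := evalEnd_monomial (δ := δ) _ _ _
  rw [h]; rfl

theorem ev_X (c : K) : ev δ c X = pseudoEnd δ c := by
  have h : ev δ c X = (1 : K) • (pseudoEnd δ c) ^ 1 := evalEnd_monomial (δ := δ) _ _ _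
  rw [h, pow_one, one_smul]

/-- `c` is unramified if `δ + c θ` is not a scalar multiple of the identity. -/
def Unramified (δ : SkewDerivation θ) (c : K) : Prop :=
  ¬ ∃ l : K, ∀ x : K, δ x + c * θ x = l * x

theorem exists_twist (δ : SkewDerivation θ) (h : θ ≠ RingHom.id K) :
    ∃ a : K, ∀ x, δ x = a * (θ x - x) := by
  obtain ⟨y, hy⟩ : ∃ y, θ y ≠ y := by
    by_contra hc
    push Not at hc
    exact h (RingHom.ext hc)
  have hy' : θ y - y ≠ 0 := sub_ne_zero.mpr hy
  refine ⟨δ y / (θ y - y), fun x => ?_⟩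
  have h1 := δ.leibniz x y
  have h2 := δ.leibniz y x
  rw [mul_comm x y, h2] at h1
  rw [div_mul_eq_mul_div, eq_div_iff hy']
  linear_combination h1

open scoped Classical in
/-- If `θ ≠ id`, the unique `a ∈ K` with `δ = a (θ - id)`. -/
noncomputable def twist (δ : SkewDerivation θ) : K :=
  if h : θ ≠ RingHom.id K then (exists_twist δ h).choose else 0

theorem twist_spec (h : θ ≠ RingHom.id K) (x : K) : δ x = twist δ * (θ x - x) := by
  rw [twist, dif_pos h]
  exact (exists_twist δ h).choose_spec x

theorem degree_wf : WellFounded fun p q : OrePoly δ => p.degree < q.degree :=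
  InvImage.wf (fun p : OrePoly δ => p.degree) wellFounded_lt

open scoped Classical in
/-- The minimal polynomial of `δ` over `K`: the monic polynomial of minimal degree with
`P(δ) = 0`. -/
noncomputable def minPoly (δ : SkewDerivation θ) : OrePoly δ :=
  if h : ∃ p : OrePoly δ, p.Monic ∧ ev δ 0 p = 0 then
    degree_wf.min {p : OrePoly δ | p.Monic ∧ ev δ 0 p = 0} h
  else 0

open scoped Classical in
/-- The normalized generator `Z(X)` of the centre: the minimal polynomial of `δ` if `θ = id`, and
`(X + a) ^ [K : F]` if `θ ≠ id` and `δ = a (θ - id)`. -/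
noncomputable def centralZ (δ : SkewDerivation θ) : OrePoly δ :=
  if θ = RingHom.id K then minPoly δ else (X + C (twist δ)) ^ finrank δ.constants K

/-- `υ(c)`: the remainder of the right Euclidean division of `Z(X)` by `X - c`, a constant. -/
noncomputable def upsilon (δ : SkewDerivation θ) (c : K) : K :=
  (rightRem (centralZ δ) (X - C c)).coeff 0

/-- The polynomial `Z(X) - z`. -/
noncomputable def place (δ : SkewDerivation θ) (z : K) : OrePoly δ := centralZ δ - C z

theorem minPoly_comm_C (hθ : θ = RingHom.id K) (a : K) : minPoly δ * C a = C a * minPoly δ := by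
  classical
  rw [minPoly]
  split_ifs with h
  swap
  · rw [zero_mul, mul_zero]
  set p := degree_wf.min {p : OrePoly δ | p.Monic ∧ ev δ 0 p = 0} h with hp
  have hmem : p.Monic ∧ ev δ 0 p = 0 := degree_wf.min_mem _ h
  have hmin : ∀ q : OrePoly δ, q.Monic → ev δ 0 q = 0 → ¬ q.degree < p.degree := fun q h1 h2 =>
    degree_wf.not_lt_min {p : OrePoly δ | p.Monic ∧ ev δ 0 p = 0} (x := q) (And.intro h1 h2)
  by_contra hne
  have hr0 : p * C a - C a * p ≠ 0 := sub_ne_zero.mpr hne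
  have hp0 : p ≠ 0 := by
    intro h0
    rw [h0, zero_mul, mul_zero, sub_self] at hr0
    exact hr0 rfl
  set r := p * C a - C a * p with hr
  obtain ⟨n, hn, hn'⟩ := exists_top hp0
  have hcoeff : ∀ i, r.coeff i = (p * C a).coeff i - a * p.coeff i := by
    intro i
    rw [hr, C_mul, ← coeff_smul]
    exact Polynomial.coeff_sub _ _ _
  have hC : ∀ i, 0 < i → (C a : OrePoly δ).coeff i = 0 := by
    intro i hi
    change (monomial 0 a : OrePoly δ).coeff i = 0
    rw [coeff_monomial, if_neg (by omega)]
  have hC0 : (C a : OrePoly δ).coeff 0 = a := by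
    change (monomial 0 a : OrePoly δ).coeff 0 = a
    rw [coeff_monomial, if_pos rfl]
  have hid : ∀ (m : ℕ) (x : K), θ^[m] x = x := by
    intro m x
    induction m with
    | zero => rfl
    | succ m ih => rw [Function.iterate_succ_apply', ih, hθ, RingHom.id_apply]
  have hdeg : r.degree < p.degree := by
    refine lt_of_lt_of_le (b := (n : WithBot ℕ)) (degree_lt_iff.mpr fun i hi => ?_)
      (Polynomial.le_degree_of_ne_zero hn)
    have htop := mul_top hC n p hn'
    rw [zero_add, hC0, hid] at htop
    rcases hi.eq_or_lt with rfl | hi'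
    · rw [hcoeff, htop.1, mul_comm, sub_self]
    · rw [hcoeff, htop.2 i hi', hn' i hi', mul_zero, sub_zero]
  have hev : ev δ 0 r = 0 := by
    rw [hr, map_sub, map_mul, map_mul, hmem.2, zero_mul, mul_zero, sub_zero]
  set l := Polynomial.leadingCoeff (show Polynomial K from r) with hl
  have hl0 : l ≠ 0 := Polynomial.leadingCoeff_ne_zero.mpr hr0
  refine hmin (l⁻¹ • r) ?_ (by rw [ev_smul, hev, smul_zero]) ?_
  · have : (show Polynomial K from (l⁻¹ • r)) = Polynomial.C l⁻¹ * (show Polynomial K from r) :=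
      Polynomial.smul_eq_C_mul _
    change Polynomial.Monic (show Polynomial K from (l⁻¹ • r))
    rw [this, Polynomial.Monic, Polynomial.leadingCoeff_mul, Polynomial.leadingCoeff_C, ← hl,
      inv_mul_cancel₀ hl0]
  · exact lt_of_le_of_lt (Polynomial.degree_smul_le _ _) hdeg

/-- `Z(X)` commutes with the constants. -/
theorem centralZ_mul_C [FiniteDimensional δ.constants K] (a : K) :
    centralZ δ * C a = C a * centralZ δ := by
  classical
  rw [centralZ]
  split_ifs with hθ
  · exact minPoly_comm_C hθ a
  · have hX : ∀ b : K, (X + C (twist δ)) * C b = C (θ b) * (X + C (twist δ) : OrePoly δ) := by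
      intro b
      rw [add_mul, X_mul_C, twist_spec hθ, mul_add, add_assoc, ← map_mul, ← map_mul, ← map_add]
      congr 2
      ring
    have hXn : ∀ (n : ℕ) (b : K), (X + C (twist δ)) ^ n * C b
        = C (θ^[n] b) * (X + C (twist δ) : OrePoly δ) ^ n := by
      intro n
      induction n with
      | zero => intro b; simp
      | succ n ih =>
        intro b
        rw [pow_succ, mul_assoc, hX, ← mul_assoc, ih, Function.iterate_succ_apply, mul_assoc]
    rw [hXn]
    congr 2
    have hF : ∀ f : δ.constants, θ (f : K) = f := fun f => (SkewDerivation.mem_constants.mp f.2).1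
    let θ' : K →ₐ[δ.constants] K := { θ with commutes' := hF }
    have hbij : Function.Bijective θ' :=
      ⟨θ'.toRingHom.injective,
        (LinearMap.injective_iff_surjective (f := θ'.toLinearMap)).mp θ'.toRingHom.injective⟩
    let σ : Gal(K/δ.constants) := AlgEquiv.ofBijective θ' hbij
    have hσ : ∀ x, σ x = θ x := fun x => rfl
    have hfix : IntermediateField.fixedField (Subgroup.zpowers σ) = ⊥ := by
      rw [eq_bot_iff]
      intro x hx
      rw [IntermediateField.mem_fixedField_iff] at hx
      have h1 : θ x = x := (hσ x).symm.trans (hx σ (Subgroup.mem_zpowers σ))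
      rw [IntermediateField.mem_bot]
      exact ⟨⟨x, h1, by rw [twist_spec hθ, h1, sub_self, mul_zero]⟩, rfl⟩
    have hcard : finrank δ.constants K = orderOf σ := by
      have := IntermediateField.finrank_fixedField_eq_card (Subgroup.zpowers σ)
      rw [hfix, IntermediateField.finrank_bot', Nat.card_zpowers] at this
      exact this
    have hpow : ∀ (n : ℕ) (x : K), (σ ^ n) x = θ^[n] x := by
      intro n
      induction n with
      | zero => intro x; rfl
      | succ n ih => intro x; rw [pow_succ, AlgEquiv.mul_apply, ih, Function.iterate_succ_apply, hσ]
    rw [← hpow, hcard, pow_orderOf_eq_one]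
    rfl

theorem ev_place [FiniteDimensional δ.constants K] (c : K) :
    ev δ c (place δ (upsilon δ c)) = 0 := by
  have hB : (X - C c : OrePoly δ) ≠ 0 := by
    intro h
    have : (X - C c : OrePoly δ).coeff 1 = 1 := by
      rw [show (X - C c : OrePoly δ).coeff 1 = (X : OrePoly δ).coeff 1 - (C c : OrePoly δ).coeff 1
        from Polynomial.coeff_sub _ _ _]
      change (monomial 1 1 : OrePoly δ).coeff 1 - (monomial 0 c : OrePoly δ).coeff 1 = 1
      rw [coeff_monomial, coeff_monomial]; simp
    rw [h, coeff_zero] at this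
    exact zero_ne_one this
  obtain ⟨hdeg, Q, hQ⟩ := rightRem_spec (centralZ δ) hB
  have hdeg1 : (rightRem (centralZ δ) (X - C c)).degree < ((1 : ℕ) : WithBot ℕ) := by
    refine lt_of_lt_of_le hdeg (Order.le_of_lt_succ ?_)
    have : (X - C c : OrePoly δ).degree < ((2 : ℕ) : WithBot ℕ) := by
      rw [degree_lt_iff]
      intro i hi
      rw [show (X - C c : OrePoly δ).coeff i = (X : OrePoly δ).coeff i - (C c : OrePoly δ).coeff i
        from Polynomial.coeff_sub _ _ _]
      change (monomial 1 1 : OrePoly δ).coeff i - (monomial 0 c : OrePoly δ).coeff i = 0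
      rw [coeff_monomial, coeff_monomial, if_neg (by omega), if_neg (by omega), sub_zero]
    exact this
  have hrem : rightRem (centralZ δ) (X - C c) = C (upsilon δ c) := by
    apply ext_coeff
    intro n
    change _ = (monomial 0 _ : OrePoly δ).coeff n
    rw [coeff_monomial]
    rcases Nat.eq_zero_or_pos n with rfl | hn
    · rw [if_pos rfl, upsilon]
    · rw [if_neg (by omega), degree_lt_iff.mp hdeg1 n hn]
  have h1 : ev δ c (centralZ δ) 1 = upsilon δ c := by
    rw [hQ, hrem, map_add, map_mul, LinearMap.add_apply, ev_C, Module.End.mul_apply, map_sub,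
      LinearMap.sub_apply, ev_X, pseudoEnd_apply, ev_C, δ.map_one_eq, map_one]
    simp
  ext x
  have h2 : ev δ c (centralZ δ) x = upsilon δ c * x := by
    have := congrArg (fun p => ev δ c p 1) (centralZ_mul_C (δ := δ) x)
    simp only [map_mul, Module.End.mul_apply, ev_C, h1, mul_one] at this
    rw [this, mul_comm]
  rw [place, map_sub, LinearMap.sub_apply, h2, ev_C, sub_self, LinearMap.zero_apply]

end OrePoly

namespace OrePoly

open Module

variable {K : Type*} [Field K] {θ : K →+* K} {δ : SkewDerivation θ}

/-! ### Taylor expansions and skew residues -/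

open scoped nonZeroDivisors in
/-- The fraction skew field of `K[X; θ, δ]`. -/
abbrev FracField (δ : SkewDerivation θ) : Type _ := OreLocalization (OrePoly δ)⁰ (OrePoly δ)

open scoped nonZeroDivisors in
/-- The inclusion of the Ore polynomials in their fraction field. -/
noncomputable def toFrac (δ : SkewDerivation θ) : OrePoly δ →+* FracField δ :=
  { (OreLocalization.numeratorHom : OrePoly δ →* FracField δ) with
    map_zero' := OreLocalization.zero_oreDiv 1
    map_add' := fun _ _ => OreLocalization.add_oreDiv.symm }

/-- The two-sided ideal generated by `N ^ m`, where `N = Z(X) - z`. -/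
noncomputable def placeIdeal (δ : SkewDerivation θ) (z : K) (m : ℕ) : TwoSidedIdeal (OrePoly δ) :=
  TwoSidedIdeal.span {place δ z ^ m}

/-- `A⁺ / N ^ m A⁺`. -/
abbrev QuotPow (δ : SkewDerivation θ) (z : K) (m : ℕ) : Type _ :=
  (placeIdeal δ z m).ringCon.Quotient

/-- The projection `A⁺ → A⁺ / N ^ m A⁺`. -/
noncomputable def proj (δ : SkewDerivation θ) (z : K) (m : ℕ) : OrePoly δ →+* QuotPow δ z m :=
  (placeIdeal δ z m).ringCon.mk'

theorem placeIdeal_succ_le (z : K) (m : ℕ) : placeIdeal δ z (m + 1) ≤ placeIdeal δ z m := by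
  rw [placeIdeal, TwoSidedIdeal.span_le]
  rintro _ rfl
  rw [pow_succ]
  exact TwoSidedIdeal.mul_mem_right _ _ _ (TwoSidedIdeal.subset_span rfl)

/-- The transition map `A⁺ / N ^ (m + 1) A⁺ → A⁺ / N ^ m A⁺`. -/
noncomputable def transition (δ : SkewDerivation θ) (z : K) (m : ℕ) :
    QuotPow δ z (m + 1) →+* QuotPow δ z m :=
  RingCon.map _ _ (TwoSidedIdeal.ringCon_le_iff.mp (placeIdeal_succ_le z m))

/-- The inverse limit of the `A⁺ / N ^ m A⁺`. -/
def completion (δ : SkewDerivation θ) (z : K) : Subring (∀ m : ℕ, QuotPow δ z m) where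
  carrier := {x | ∀ m, transition δ z m (x (m + 1)) = x m}
  mul_mem' hx hy m := by rw [Pi.mul_apply, map_mul, hx m, hy m, Pi.mul_apply]
  one_mem' m := map_one _
  add_mem' hx hy m := by rw [Pi.add_apply, map_add, hx m, hy m, Pi.add_apply]
  zero_mem' m := map_zero _
  neg_mem' hx m := by rw [Pi.neg_apply, map_neg, hx m, Pi.neg_apply]

/-- The canonical map from `A⁺` to the completion. -/
noncomputable def toCompletion (δ : SkewDerivation θ) (z : K) : OrePoly δ →+* completion δ z :=
  (RingHom.pi fun m => proj δ z m).codRestrict (completion δ z) fun _ _ => rfl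

/-- The residue ring `A⁺ / N A⁺`. -/
abbrev ResidueRing (δ : SkewDerivation θ) (z : K) : Type _ := QuotPow δ z 1

/-- A `z`-admissible isomorphism: an isomorphism of `K`-algebras from the completion onto
`(A⁺ / N A⁺)⟦T⟧`, mapping `N` to `T` and inducing the identity of `A⁺ / N A⁺` after quotienting out
by `N` on the left and by `T` on the right. -/
structure IsAdmissible (δ : SkewDerivation θ) (z : K)
    (e : completion δ z ≃+* PowerSeries (ResidueRing δ z)) : Prop where
  map_C : ∀ a : K, e (toCompletion δ z (C a)) = PowerSeries.C (proj δ z 1 (C a))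
  map_place : e (toCompletion δ z (place δ z)) = PowerSeries.X
  constantCoeff_eq : ∀ x : completion δ z, PowerSeries.constantCoeff (e x) = x.1 1

/-- A Taylor expansion map at `z`: a ring homomorphism from the fraction field to
`(A⁺ / N A⁺)((T))` extending the composite of the canonical map from `A⁺` to the completion with a
`z`-admissible isomorphism. -/
def IsTaylorExpansion (δ : SkewDerivation θ) (z : K)
    (TS : FracField δ →+* LaurentSeries (ResidueRing δ z)) : Prop :=
  ∃ e : completion δ z ≃+* PowerSeries (ResidueRing δ z), IsAdmissible δ z e ∧
    ∀ f : OrePoly δ, TS (toFrac δ f)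
      = HahnSeries.ofPowerSeries ℤ (ResidueRing δ z) (e (toCompletion δ z f))

/-- `f` has no pole. -/
def NoPole {z : K} (TS : FracField δ →+* LaurentSeries (ResidueRing δ z)) (f : FracField δ) :
    Prop := ∀ j : ℤ, j < 0 → (TS f).coeff j = 0

/-- The value in `A⁺ / N A⁺` of a fraction without pole. -/
noncomputable def value {z : K} (TS : FracField δ →+* LaurentSeries (ResidueRing δ z)) (f : FracField δ) :
    ResidueRing δ z := (TS f).coeff 0

/-- The skew residue: the coefficient of `T⁻¹` of the Taylor expansion. -/
noncomputable def sres {z : K} (TS : FracField δ →+* LaurentSeries (ResidueRing δ z)) (f : FracField δ) :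
    ResidueRing δ z := (TS f).coeff (-1)

/-- The map `A⁺ / N A⁺ → End_F(K)` induced by `ev_c`, where `N = Z(X) - υ(c)`. -/
noncomputable def evRes (δ : SkewDerivation θ) [FiniteDimensional δ.constants K] (c : K) :
    ResidueRing δ (upsilon δ c) →+* Module.End δ.constants K :=
  RingCon.lift _ (ev δ c) (by
    have h : placeIdeal δ (upsilon δ c) 1 ≤ TwoSidedIdeal.ker (ev δ c) := by
      rw [placeIdeal, TwoSidedIdeal.span_le]
      rintro _ rfl
      rw [pow_one]
      exact (TwoSidedIdeal.mem_ker _).mpr (ev_place c)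
    exact TwoSidedIdeal.ringCon_le_iff.mp h)

/-! ### Sum-rank metric and linearized Reed-Solomon codes -/

section SumRank

variable {F : Type*} [Field F] [Module F K] {m : ℕ} {M : Fin m → Type*}
  [∀ i, AddCommGroup (M i)] [∀ i, Module F (M i)]

/-- The sum-rank weight. -/
noncomputable def sumRankWeight (φ : ∀ i, M i →ₗ[F] K) : ℕ := ∑ i, finrank F (LinearMap.range (φ i))

/-- The sum-rank distance. -/
noncomputable def sumRankDist (φ ψ : ∀ i, M i →ₗ[F] K) : ℕ := sumRankWeight (φ - ψ)

end SumRank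

variable {m : ℕ}

/-- The Ore polynomials of degree less than `k`. -/
noncomputable def degreeLT (δ : SkewDerivation θ) (k : ℕ) : Submodule K (OrePoly δ) where
  carrier := {p | p.degree < k}
  add_mem' {p q} hp hq := by
    simp only [Set.mem_ofPred_eq, degree_lt_iff] at hp hq ⊢
    intro i hi
    rw [coeff_add, hp i hi, hq i hi, add_zero]
  zero_mem' := by
    simp only [Set.mem_ofPred_eq, degree_lt_iff]
    exact fun i _ => coeff_zero i
  smul_mem' a p hp := by
    simp only [Set.mem_ofPred_eq, degree_lt_iff] at hp ⊢
    intro i hi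
    rw [coeff_smul, hp i hi, mul_zero]

/-- `P ↦ (ev_{c₁}(P) restricted to V₁, …, ev_{cₘ}(P) restricted to Vₘ)`. -/
noncomputable def evTuple (δ : SkewDerivation θ) (c : Fin m → K)
    (V : Fin m → Submodule δ.constants K) :
    OrePoly δ →ₗ[K] (∀ i, V i →ₗ[δ.constants] K) where
  toFun P i := (ev δ (c i) P).domRestrict (V i)
  map_add' P Q := by funext i; rw [map_add]; rfl
  map_smul' a P := by funext i; rw [ev_smul]; rfl

/-- The linearized Reed-Solomon code `LRS(k, c, V)`. -/
noncomputable def LRS (δ : SkewDerivation θ) (k : ℕ) (c : Fin m → K)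
    (V : Fin m → Submodule δ.constants K) : Submodule K (∀ i, V i →ₗ[δ.constants] K) :=
  (degreeLT δ k).map (evTuple δ c V)

/-! ### Linearized Goppa codes -/

/-- `D'` is monic of degree `∑ dim Vᵢ` and `ev_{cᵢ}(D')` vanishes on `Vᵢ` for all `i`. -/
structure IsVanishing (δ : SkewDerivation θ) (c : Fin m → K)
    (V : Fin m → Submodule δ.constants K) (D' : OrePoly δ) : Prop where
  monic : D'.Monic
  degree_eq : D'.degree = ((∑ i, finrank δ.constants (V i) : ℕ) : WithBot ℕ)
  vanish : ∀ i, ∀ x ∈ V i, ev δ (c i) D' x = 0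

/-- `N = ∏ (Z(X) - υ(cᵢ))`; the factors are central. -/
noncomputable def modulus (δ : SkewDerivation θ) (c : Fin m → K) : OrePoly δ :=
  (List.ofFn fun i => place δ (upsilon δ (c i))).prod

/-- `D` is the cofactor in `N` of the monic polynomial `D'` of degree `∑ dim Vᵢ` whose evaluation
at each `cᵢ` vanishes on `Vᵢ`. -/
def IsGoppaDenominator (δ : SkewDerivation θ) (c : Fin m → K)
    (V : Fin m → Submodule δ.constants K) (D : OrePoly δ) : Prop :=
  ∃ D' : OrePoly δ, IsVanishing δ c V D' ∧ D' * D = modulus δ c ∧ D * D' = modulus δ c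

open scoped Classical in
/-- The fraction `P`, namely `D⁻¹` if `θ = id`, and `Z(X)^(-m-1) (X + a)^(n-k) D⁻¹` if `θ ≠ id` and
`δ = a (θ - id)`, where `n = ∑ dim (K / Vᵢ)`. -/
noncomputable def goppaP (δ : SkewDerivation θ) (k : ℕ)
    (V : Fin m → Submodule δ.constants K) (D : OrePoly δ) : FracField δ :=
  if θ = RingHom.id K then (toFrac δ D)⁻¹
  else (toFrac δ (centralZ δ))⁻¹ ^ (m + 1) *
    toFrac δ (X + C (twist δ)) ^ (∑ i, finrank δ.constants (K ⧸ V i) - k) * (toFrac δ D)⁻¹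

open scoped Classical in
/-- The map `K ⧸ V → M` induced by a linear map `f : K → M` vanishing on `V` (and `0` if `f` does
not vanish on `V`). -/
noncomputable def descend {F M : Type*} [Field F] [Module F K] [AddCommGroup M] [Module F M]
    (V : Submodule F K) (f : K →ₗ[F] M) : (K ⧸ V) →ₗ[F] M :=
  if h : V ≤ LinearMap.ker f then V.liftQ f h else 0

variable [FiniteDimensional δ.constants K]

/-- `γ(f) = (ev_{c₁}(sres_{z₁}(f)), …, ev_{cₘ}(sres_{zₘ}(f)))`, with `zᵢ = υ(cᵢ)`. -/
noncomputable def gamma (c : Fin m → K) (V : Fin m → Submodule δ.constants K)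
    (TS : ∀ i, FracField δ →+* LaurentSeries (ResidueRing δ (upsilon δ (c i))))
    (f : FracField δ) (i : Fin m) : (K ⧸ V i) →ₗ[δ.constants] K :=
  descend (V i) (evRes δ (c i) (sres (TS i) f))

/-- The linearized Goppa code `LG(k, c, V)`, the image by `γ` of `A⁺_{<k} P`. -/
noncomputable def LG (k : ℕ) (c : Fin m → K) (V : Fin m → Submodule δ.constants K) (D : OrePoly δ)
    (TS : ∀ i, FracField δ →+* LaurentSeries (ResidueRing δ (upsilon δ (c i)))) :
    Set (∀ i, (K ⧸ V i) →ₗ[δ.constants] K) :=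
  gamma c V TS '' {f | ∃ Q ∈ degreeLT δ k, f = toFrac δ Q * goppaP δ k V D}

/-- `P Nᵢ`, with `Nᵢ = Z(X) - υ(cᵢ)`. -/
noncomputable def goppaPN (k : ℕ) (c : Fin m → K) (V : Fin m → Submodule δ.constants K)
    (D : OrePoly δ) (i : Fin m) : FracField δ :=
  goppaP δ k V D * toFrac δ (place δ (upsilon δ (c i)))

/-- The value at `cᵢ` of `P Nᵢ`, an endomorphism of `K`. -/
noncomputable def tauTilde (k : ℕ) (c : Fin m → K) (V : Fin m → Submodule δ.constants K)
    (D : OrePoly δ) (TS : ∀ i, FracField δ →+* LaurentSeries (ResidueRing δ (upsilon δ (c i))))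
    (i : Fin m) : Module.End δ.constants K :=
  evRes δ (c i) (value (TS i) (goppaPN k c V D i))

/-- `Wᵢ`, the image of the value at `cᵢ` of `P Nᵢ`. -/
noncomputable def goppaW (k : ℕ) (c : Fin m → K) (V : Fin m → Submodule δ.constants K)
    (D : OrePoly δ) (TS : ∀ i, FracField δ →+* LaurentSeries (ResidueRing δ (upsilon δ (c i))))
    (i : Fin m) : Submodule δ.constants K :=
  LinearMap.range (tauTilde k c V D TS i)

/-- `τᵢ : K / Vᵢ → Wᵢ`, the map induced by the value at `cᵢ` of `P Nᵢ`. -/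
noncomputable def tau (k : ℕ) (c : Fin m → K) (V : Fin m → Submodule δ.constants K)
    (D : OrePoly δ) (TS : ∀ i, FracField δ →+* LaurentSeries (ResidueRing δ (upsilon δ (c i))))
    (i : Fin m) : (K ⧸ V i) →ₗ[δ.constants] goppaW k c V D TS i :=
  descend (V i) (tauTilde k c V D TS i).rangeRestrict

/-- `Ψ : (φᵢ)ᵢ ↦ (φᵢ ∘ τᵢ)ᵢ`. -/
noncomputable def Psi (k : ℕ) (c : Fin m → K) (V : Fin m → Submodule δ.constants K)
    (D : OrePoly δ) (TS : ∀ i, FracField δ →+* LaurentSeries (ResidueRing δ (upsilon δ (c i)))) :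
    (∀ i, goppaW k c V D TS i →ₗ[δ.constants] K) →ₗ[K] (∀ i, (K ⧸ V i) →ₗ[δ.constants] K) where
  toFun φ i := (φ i).comp (tau k c V D TS i)
  map_add' _ _ := rfl
  map_smul' _ _ := rfl

end OrePoly

/-! ### Coefficients, degrees and the centre of the Ore polynomials -/

namespace OrePoly

open Module

variable {K : Type*} [Field K] {θ : K →+* K} {δ : SkewDerivation θ}

/-! A Taylor expansion sends N_i to T, so the residue of QP at z_i is the value of Q P N_i there. If
S is central and invertible at z_i, the value of B S⁻¹ is S⁻¹B computed in the residue ring; it does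
not depend on the Taylor expansion, and a left factor Q can be pulled out. Hence ev(sres(QP)) =
ev(Q) ∘ τ̃_i. A Goppa codeword is thus a Reed-Solomon codeword precomposed with the τ_i, and since
the τ_i are isomorphisms, ranks are preserved. This is `IsGoppaDenominator.exists_value`.

The kernel of τ̃_i is found by clearing denominators. Write N = N_i S_i. Then D⁻¹ N_i S_i = D', and
S_i acts at c_i as the nonzero product of the z_i - z_j. If θ ≠ id, the extra factors are a power of
Z, which acts as a nonzero scalar, and a power of X + a, which acts injectively. So the kernel is
that of D', which equals V_i for degree reasons (`IsVanishing.ker_ev`).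

Both points use the structure of ev_c at an unramified c: it is surjective by a density argument
(`Unramified.exists_separating`), and counting dimensions over K shows that its kernel is generated
by Z - υ(c). So A⁺/N A⁺ is identified with End_F(K) (`Unramified.evRes_bijective`). Together with
the Chinese remainder theorem this gives existence and uniqueness of D', hence of D.

For the existence of Taylor expansions, u = δ + cθ is deformed to u + t hθ with h in K. Along this
deformation N becomes a polynomial in t over F, with a simple zero at t = 0 for suitable h
(`Unramified.exists_deformation`). Reparametrizing turns it into T. The resulting map extends to the
completion, and to fractions because nonzero Ore polynomials become invertible Laurent series
(`IsTaylorLift.isUnit`). -/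

theorem coeff_sub (p q : OrePoly δ) (n : ℕ) : (p - q).coeff n = p.coeff n - q.coeff n :=
  Polynomial.coeff_sub _ _ _

theorem coeff_C (a : K) (n : ℕ) : (C a : OrePoly δ).coeff n = if n = 0 then a else 0 := by
  change (monomial 0 a : OrePoly δ).coeff n = _
  rw [coeff_monomial]
  simp only [eq_comm]

theorem coeff_X (n : ℕ) : (X : OrePoly δ).coeff n = if n = 1 then 1 else 0 := by
  change (monomial 1 1 : OrePoly δ).coeff n = _
  rw [coeff_monomial]
  simp only [eq_comm]

theorem monic_of_coeff {p : OrePoly δ} {n : ℕ} (h1 : p.coeff n = 1)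
    (h2 : ∀ i, n < i → p.coeff i = 0) : p.Monic ∧ p.degree = n := by
  have hm : p.Monic := Polynomial.monic_of_natDegree_le_of_coeff_eq_one (R := K) n
    (Polynomial.natDegree_le_iff_coeff_eq_zero.mpr h2) h1
  refine ⟨hm, le_antisymm ?_ (Polynomial.le_degree_of_ne_zero (R := K) ?_)⟩
  · exact Polynomial.degree_le_iff_coeff_zero (R := K) _ _ |>.mpr
      fun i hi => h2 i (by exact_mod_cast hi)
  · change p.coeff n ≠ 0
    rw [h1]; exact one_ne_zero

theorem Monic.coeff_eq_one {p : OrePoly δ} (hp : p.Monic) {n : ℕ} (h : p.degree = n) :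
    p.coeff n = 1 := by
  have : Polynomial.natDegree (R := K) p = n := Polynomial.natDegree_eq_of_degree_eq_some h
  rw [← this]; exact hp

theorem coeff_eq_zero_of_degree_eq {p : OrePoly δ} {n : ℕ} (h : p.degree = n) {i : ℕ}
    (hi : n < i) : p.coeff i = 0 :=
  Polynomial.coeff_eq_zero_of_degree_lt (R := K) (by
    change p.degree < _; rw [h]; exact_mod_cast hi)

theorem Monic.ne_zero {p : OrePoly δ} (hp : p.Monic) : p ≠ 0 :=
  Polynomial.Monic.ne_zero (R := K) hp

theorem exists_degree_eq {p : OrePoly δ} (hp : p ≠ 0) : ∃ n : ℕ, p.degree = n :=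
  ⟨_, Polynomial.degree_eq_natDegree (R := K) hp⟩

theorem exists_monic_smul {p : OrePoly δ} (hp : p ≠ 0) :
    ∃ l : K, l ≠ 0 ∧ (l • p).Monic ∧ (l • p).degree = p.degree := by
  obtain ⟨n, hn, hn'⟩ := exists_top hp
  have h := monic_of_coeff (p := (p.coeff n)⁻¹ • p) (n := n)
    (by rw [coeff_smul, inv_mul_cancel₀ hn])
    (fun i hi => by rw [coeff_smul, hn' i hi, mul_zero])
  refine ⟨(p.coeff n)⁻¹, inv_ne_zero hn, h.1, h.2.trans (le_antisymm ?_ ?_)⟩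
  · exact Polynomial.le_degree_of_ne_zero (R := K) hn
  · exact Polynomial.degree_le_iff_coeff_zero (R := K) _ _ |>.mpr
      fun i hi => hn' i (by exact_mod_cast hi)

/-- Coordinates on the Ore polynomials of degree less than `n`. -/
noncomputable def degreeLTEquiv (δ : SkewDerivation θ) (n : ℕ) : degreeLT δ n ≃ₗ[K] (Fin n → K) :=
  LinearEquiv.trans (M₂ := Polynomial.degreeLT K n)
    { toFun := fun p => ⟨p.1, Polynomial.mem_degreeLT.mpr p.2⟩
      invFun := fun p => ⟨p.1, Polynomial.mem_degreeLT.mp p.2⟩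
      map_add' := fun _ _ => rfl
      map_smul' := fun _ _ => rfl
      left_inv := fun _ => rfl
      right_inv := fun _ => rfl }
    (Polynomial.degreeLTEquiv K n)

theorem finrank_degreeLT (δ : SkewDerivation θ) (n : ℕ) : finrank K (degreeLT δ n) = n := by
  rw [(degreeLTEquiv δ n).finrank_eq, finrank_fin_fun]

instance finite_degreeLT (δ : SkewDerivation θ) (n : ℕ) : Module.Finite K (degreeLT δ n) :=
  Module.Finite.equiv (degreeLTEquiv δ n).symm

/-- An Ore polynomial commuting with the constants and with `X` is central. -/
theorem mem_center_of_comm {p : OrePoly δ} (hC : ∀ a, p * C a = C a * p) (hX : p * X = X * p) :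
    p ∈ Subring.center (OrePoly δ) := by
  rw [Subring.mem_center_iff]
  intro q
  induction q using OrePoly.induction with
  | hadd q r hq hr => rw [add_mul, mul_add, hq, hr]
  | hmon n a =>
    rw [monomial_eq]
    exact ((Commute.mul_right (hC a) ((show Commute p X from hX).pow_right n))).symm

theorem mul_X_coeff_succ (p : OrePoly δ) (n : ℕ) : (p * X).coeff (n + 1) = p.coeff n := by
  induction p using OrePoly.induction with
  | hadd p q hp hq => rw [add_mul, coeff_add, coeff_add, hp, hq]
  | hmon i a =>
    rw [monomial_eq, mul_assoc, ← pow_succ, ← monomial_eq, ← monomial_eq, coeff_monomial,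
      coeff_monomial]
    simp

theorem X_add_C_pow_coeff (a : K) (n : ℕ) :
    ((X + C a : OrePoly δ) ^ n).coeff n = 1 ∧
      ∀ i, n < i → ((X + C a : OrePoly δ) ^ n).coeff i = 0 := by
  have h1 : ∀ i, 1 < i → (X + C a : OrePoly δ).coeff i = 0 := fun i hi => by
    rw [coeff_add, coeff_X, coeff_C, if_neg (by omega), if_neg (by omega), add_zero]
  induction n with
  | zero =>
    rw [pow_zero, ← map_one C]
    refine ⟨by rw [coeff_C, if_pos rfl], fun i hi => by rw [coeff_C, if_neg (by omega)]⟩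
  | succ n ih =>
    have h := mul_top h1 n _ ih.2
    rw [pow_succ, add_comm n 1]
    refine ⟨h.1.trans ?_, h.2⟩
    have hc : (X + C a : OrePoly δ).coeff 1 = 1 := by
      rw [coeff_add, coeff_X, coeff_C, if_pos rfl, if_neg (by omega), add_zero]
    rw [ih.1, hc, one_mul]
    exact iterate_map_one θ n

/-! ### Density, and the kernel and image of the evaluation maps -/

section Eval

variable {c : K}

/-- A scalar commuting with an unramified `δ + c θ` is a constant. -/
theorem Unramified.mem_constants (hc : Unramified δ c) {l : K}
    (hl : ∀ x, pseudoEnd δ c (l * x) = l * pseudoEnd δ c x) : l ∈ δ.constants := by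
  have h : ∀ x, (θ l - l) * pseudoEnd δ c x = - δ l * x := fun x => by
    have h1 := pseudoEnd_smul (δ := δ) c l x
    rw [smul_eq_mul, hl, smul_eq_mul, smul_eq_mul] at h1
    linear_combination -h1
  have hθ : θ l = l := by
    by_contra hne
    have hne' : θ l - l ≠ 0 := sub_ne_zero.mpr hne
    refine hc ⟨- δ l / (θ l - l), fun x => ?_⟩
    rw [div_mul_eq_mul_div, eq_div_iff hne', ← h x, pseudoEnd_apply]
    ring
  refine SkewDerivation.mem_constants.mpr ⟨hθ, ?_⟩
  have := h 1
  rw [hθ, sub_self, zero_mul, mul_one] at this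
  exact neg_eq_zero.mp this.symm

theorem ev_C_mul (c a x : K) (P : OrePoly δ) : ev δ c (C a * P) x = a * ev δ c P x := by
  rw [map_mul, Module.End.mul_apply, ev_C]

theorem Unramified.not_trivial (hc : Unramified δ c) :
    ¬ (θ = RingHom.id K ∧ ∀ x : K, δ x = 0) := by
  rintro ⟨h1, h2⟩
  exact hc ⟨c, fun x => by rw [h2, zero_add, DFunLike.congr_fun h1 x, RingHom.id_apply]⟩

theorem C_mem_center {z : K} (hz : z ∈ δ.constants) : C z ∈ Subring.center (OrePoly δ) := by
  rw [SkewDerivation.mem_constants] at hz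
  refine mem_center_of_comm (fun a => by rw [← map_mul, ← map_mul, mul_comm]) ?_
  rw [X_mul_C, hz.1, hz.2, map_zero, add_zero]

variable [FiniteDimensional δ.constants K]

/-- The evaluation map as a map of left `K`-vector spaces. -/
noncomputable def evLin (δ : SkewDerivation θ) (c : K) :
    OrePoly δ →ₗ[K] Module.End δ.constants K where
  toFun := ev δ c
  map_add' := map_add _
  map_smul' := ev_smul c

/-- End_F(K) has dimension s over K acting on the left, one less than the space of Ore polynomials
of degree at most s. -/
theorem exists_monic_ev_eq_zero (c : K) : ∃ p : OrePoly δ, p.Monic ∧ ev δ c p = 0 := by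
  set s := finrank δ.constants K
  have hni : ¬ Function.Injective ((evLin δ c).domRestrict (degreeLT δ (s + 1))) := by
    intro hi
    have := LinearMap.finrank_le_finrank_of_injective hi
    rw [finrank_degreeLT, finrank_linearMap_self] at this
    omega
  rw [← LinearMap.ker_eq_bot, Submodule.eq_bot_iff] at hni
  push Not at hni
  obtain ⟨p, hp, hp0⟩ := hni
  have hp0' : (p : OrePoly δ) ≠ 0 := fun h => hp0 (Subtype.ext h)
  obtain ⟨l, -, hm, -⟩ := exists_monic_smul hp0'
  refine ⟨_, hm, ?_⟩
  have : ev δ c p = 0 := hp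
  rw [ev_smul, this, smul_zero]

theorem minPoly_spec : (minPoly δ).Monic ∧ ev δ 0 (minPoly δ) = 0 ∧
    ∀ q : OrePoly δ, ev δ 0 q = 0 → q.degree < (minPoly δ).degree → q = 0 := by
  classical
  have h : ∃ p : OrePoly δ, p.Monic ∧ ev δ 0 p = 0 := exists_monic_ev_eq_zero 0
  rw [minPoly, dif_pos h]
  set p := degree_wf.min {p : OrePoly δ | p.Monic ∧ ev δ 0 p = 0} h with hp
  have hmem : p.Monic ∧ ev δ 0 p = 0 := degree_wf.min_mem _ h
  refine ⟨hmem.1, hmem.2, fun q hq hlt => ?_⟩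
  by_contra hq0
  obtain ⟨l, -, hm, hd⟩ := exists_monic_smul hq0
  refine degree_wf.not_lt_min {p : OrePoly δ | p.Monic ∧ ev δ 0 p = 0} (x := l • q)
    ⟨hm, by rw [ev_smul, hq, smul_zero]⟩ ?_
  rw [hd]; exact hlt

/-- Only commutation with X is left. If θ = id, the commutator with X vanishes at δ and has degree
below that of Z, because δ kills the leading coefficient 1; by minimality it is zero. If θ ≠ id, Z
is a power of X + a and also commutes with a. -/
theorem centralZ_mem_center : centralZ δ ∈ Subring.center (OrePoly δ) := by
  refine mem_center_of_comm (fun a => centralZ_mul_C a) ?_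
  by_cases hθ : θ = RingHom.id K
  · have hZ : centralZ δ = minPoly δ := if_pos hθ
    obtain ⟨hm, he, hmin⟩ := minPoly_spec (δ := δ)
    rw [hZ]
    obtain ⟨d, hd⟩ := exists_degree_eq hm.ne_zero
    rw [← sub_eq_zero, ← neg_eq_zero, neg_sub]
    refine hmin _ (by rw [map_sub, map_mul, map_mul, he, mul_zero, zero_mul, sub_zero]) ?_
    rw [hd, degree_lt_iff]
    intro i hi
    rw [coeff_sub, X_mul]
    have hδ : δ ((minPoly δ).coeff i) = 0 := by
      rcases hi.eq_or_lt with rfl | hi'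
      · rw [hm.coeff_eq_one hd, δ.map_one_eq]
      · rw [coeff_eq_zero_of_degree_eq hd hi', map_zero]
    cases i with
    | succ j => rw [coeff_mulX_succ, hδ, mul_X_coeff_succ, DFunLike.congr_fun hθ]; simp
    -- Here the degree is 0, so the minimal polynomial is 1 and the commutator is trivially zero.
    | zero =>
      have : minPoly δ = 1 := by
        obtain rfl : d = 0 := by omega
        refine ext_coeff fun n => ?_
        rw [← map_one C, coeff_C]
        split_ifs with h
        · rw [h, hm.coeff_eq_one hd]
        · exact coeff_eq_zero_of_degree_eq hd (by omega)
      rw [← X_mul, this, one_mul, mul_one, sub_self]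
  · have hZ : centralZ δ = (X + C (twist δ)) ^ finrank δ.constants K := if_neg hθ
    have h1 : Commute (centralZ δ) (X + C (twist δ)) := by
      rw [hZ]; exact (Commute.refl _).pow_left _
    have h2 := h1.sub_right (centralZ_mul_C (twist δ))
    rwa [add_sub_cancel_right] at h2

/-- Density: operators `P(δ + c θ)` separate a point from a subspace. -/
theorem Unramified.exists_separating (hc : Unramified δ c) (W : Submodule δ.constants K) :
    ∀ x ∉ W, ∃ P : OrePoly δ, (∀ w ∈ W, ev δ c P w = 0) ∧ ev δ c P x ≠ 0 := by
  obtain ⟨S, rfl⟩ : W.FG := IsNoetherian.noetherian W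
  classical
  induction S using Finset.induction_on with
  | empty =>
    intro x hx
    refine ⟨1, fun w hw => ?_, ?_⟩
    · simp at hw; rw [hw, map_zero]
    · rw [map_one]; rintro rfl; exact hx (Submodule.zero_mem _)
  | insert w S _ ih =>
    set W := Submodule.span δ.constants (S : Set K) with hW
    have hspan : Submodule.span δ.constants ((insert w S : Finset K) : Set K)
        = Submodule.span δ.constants {w} ⊔ W := by
      rw [Finset.coe_insert, Submodule.span_insert]
    rw [hspan]
    intro x hx
    by_cases hw : w ∈ W
    · rw [sup_eq_right.mpr ((Submodule.span_singleton_le_iff_mem _ _).mpr hw)] at hx ⊢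
      exact ih x hx
    obtain ⟨P₁, hP₁, hP₁w⟩ := ih w hw
    obtain ⟨P₀, hP₀, hP₀w⟩ : ∃ P : OrePoly δ, (∀ w ∈ W, ev δ c P w = 0) ∧ ev δ c P w = 1 :=
      ⟨C (ev δ c P₁ w)⁻¹ * P₁, fun v hv => by rw [ev_C_mul, hP₁ v hv, mul_zero],
        by rw [ev_C_mul, inv_mul_cancel₀ hP₁w]⟩
    -- If x cannot be separated from Fw + W, then for P vanishing on W the value P(x) depends only
    -- on P(w). This gives P(x) = P(w) l with l = P₀(x). Once l lies in F, every such P kills x - l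
    -- w, which puts x - l w in W by induction.
    by_contra hcon
    push Not at hcon
    have hsup : ∀ Q : OrePoly δ, (∀ v ∈ W, ev δ c Q v = 0) → ev δ c Q w = 0 →
        ev δ c Q x = 0 := by
      intro Q h1 h2
      refine hcon Q fun v hv => ?_
      obtain ⟨y, hy, v', hv', rfl⟩ := Submodule.mem_sup.mp hv
      obtain ⟨r, rfl⟩ := Submodule.mem_span_singleton.mp hy
      rw [map_add, map_smul, h2, h1 v' hv', smul_zero, add_zero]
    set l := ev δ c P₀ x with hl
    have hmul : ∀ P : OrePoly δ, (∀ v ∈ W, ev δ c P v = 0) → ev δ c P x = ev δ c P w * l := by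
      intro P hP
      have := hsup (P - C (ev δ c P w) * P₀)
        (fun v hv => by
          rw [map_sub, LinearMap.sub_apply, hP v hv, ev_C_mul, hP₀ v hv, mul_zero, sub_zero])
        (by rw [map_sub, LinearMap.sub_apply, ev_C_mul, hP₀w, mul_one, sub_self])
      rw [map_sub, LinearMap.sub_apply, ev_C_mul, sub_eq_zero] at this
      exact this
    have hlF : l ∈ δ.constants := by
      refine hc.mem_constants fun b => ?_
      -- With u = δ + cθ, this polynomial sends w to u(b) and x to u(b l), so multiplication by l
      -- commutes with u.
      have := hmul (X * (C b * P₀)) fun v hv => by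
        rw [map_mul, Module.End.mul_apply, ev_C_mul, hP₀ v hv, mul_zero, map_zero]
      rw [map_mul, Module.End.mul_apply, Module.End.mul_apply, ev_C_mul, ev_C_mul, ev_X, hP₀w,
        mul_one, ← hl] at this
      rw [mul_comm l b, this, mul_comm]
    have hxW : x - (⟨l, hlF⟩ : δ.constants) • w ∈ W := by
      by_contra hne
      obtain ⟨P, hP, hPx⟩ := ih _ hne
      refine hPx ?_
      rw [map_sub, map_smul, hmul P hP, Subfield.smul_def, smul_eq_mul, mul_comm, sub_self]
    refine hx ?_
    rw [← add_sub_cancel ((⟨l, hlF⟩ : δ.constants) • w) x]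
    exact Submodule.add_mem_sup (Submodule.smul_mem _ _ (Submodule.mem_span_singleton_self w)) hxW

/-- Separating each basis vector from the span of the others gives operators dual to the basis; left
multiples by K of these span End_F(K). -/
theorem Unramified.ev_surjective (hc : Unramified δ c) : Function.Surjective (ev δ c) := by
  intro T
  let b := Module.finBasis δ.constants K
  have hP : ∀ j, ∃ P : OrePoly δ, ∀ i, ev δ c P (b i) = if i = j then 1 else 0 := by
    intro j
    have hj : b j ∉ Submodule.span δ.constants (b '' {i | i ≠ j}) :=
      b.linearIndependent.notMem_span_image (by simp)
    obtain ⟨P, hP, hPj⟩ := hc.exists_separating _ _ hj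
    refine ⟨C (ev δ c P (b j))⁻¹ * P, fun i => ?_⟩
    rw [ev_C_mul]
    split_ifs with h
    · rw [h, inv_mul_cancel₀ hPj]
    · rw [hP _ (Submodule.subset_span ⟨i, h, rfl⟩), mul_zero]
  choose P hP using hP
  refine ⟨∑ j, C (T (b j)) * P j, b.ext fun i => ?_⟩
  rw [map_sum, LinearMap.sum_apply, Finset.sum_eq_single i]
  · rw [ev_C_mul, hP, if_pos rfl, mul_one]
  · intro j _ hj
    rw [ev_C_mul, hP, if_neg hj.symm, mul_zero]
  · simp

theorem Unramified.exists_mem_degreeLT_ev_eq (hc : Unramified δ c) {p : OrePoly δ} {d : ℕ}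
    (hp0 : p ≠ 0) (hd : p.degree = d) (hp : ev δ c p = 0) (T : Module.End δ.constants K) :
    ∃ R ∈ degreeLT δ d, ev δ c R = T := by
  obtain ⟨P, rfl⟩ := hc.ev_surjective T
  obtain ⟨R, hR, Q, rfl⟩ := exists_rightDiv P hp0
  rw [hd] at hR
  exact ⟨R, hR, by rw [map_add, map_mul, hp, mul_zero, zero_add]⟩

/-- If θ = id, then δ ≠ 0 makes 0 unramified. The polynomials of degree less than d = deg Z are then
in bijection with End_F(K): injectivity is minimality, surjectivity is density followed by division.
Comparing dimensions over K gives d = s. -/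
theorem centralZ_monic (hne : ¬ (θ = RingHom.id K ∧ ∀ x : K, δ x = 0)) :
    (centralZ δ).Monic ∧ (centralZ δ).degree = finrank δ.constants K := by
  by_cases hθ : θ = RingHom.id K
  · have hZ : centralZ δ = minPoly δ := if_pos hθ
    obtain ⟨hm, he, hmin⟩ := minPoly_spec (δ := δ)
    rw [hZ]
    refine ⟨hm, ?_⟩
    have h0 : Unramified δ 0 := by
      rintro ⟨l, hl⟩
      refine hne ⟨hθ, fun x => ?_⟩
      have h1 := hl 1
      have h2 := hl x
      simp only [δ.map_one_eq, zero_mul, add_zero, mul_one] at h1 h2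
      rw [h2, ← h1, zero_mul]
    obtain ⟨d, hd⟩ := exists_degree_eq hm.ne_zero
    rw [hd]
    have hbij : Function.Bijective ((evLin δ 0).domRestrict (degreeLT δ d)) := by
      refine ⟨?_, fun T => ?_⟩
      · rw [injective_iff_map_eq_zero]
        rintro ⟨p, hp⟩ h
        exact Subtype.ext (hmin p h (hd ▸ hp))
      · obtain ⟨R, hR, h⟩ := h0.exists_mem_degreeLT_ev_eq hm.ne_zero hd he T
        exact ⟨⟨R, hR⟩, h⟩
    have := (LinearEquiv.ofBijective _ hbij).finrank_eq
    rw [finrank_degreeLT, finrank_linearMap_self] at this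
    rw [this]
  · have hZ : centralZ δ = (X + C (twist δ)) ^ finrank δ.constants K := if_neg hθ
    rw [hZ]
    exact monic_of_coeff (X_add_C_pow_coeff _ _).1 (X_add_C_pow_coeff _ _).2

theorem place_monic (hne : ¬ (θ = RingHom.id K ∧ ∀ x : K, δ x = 0)) (z : K) :
    (place δ z).Monic ∧ (place δ z).degree = finrank δ.constants K := by
  obtain ⟨h1, h2⟩ := centralZ_monic hne
  have hpos : 0 < finrank δ.constants K := finrank_pos
  refine monic_of_coeff ?_ fun i hi => ?_
  · rw [place, coeff_sub, coeff_C, if_neg hpos.ne', sub_zero, h1.coeff_eq_one h2]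
  · rw [place, coeff_sub, coeff_C, if_neg (by omega), sub_zero, coeff_eq_zero_of_degree_eq h2 hi]

theorem ev_centralZ (c : K) : ev δ c (centralZ δ) = ev δ c (C (upsilon δ c)) := by
  have := ev_place (δ := δ) c
  rwa [place, map_sub, sub_eq_zero] at this

/-- Z is central and acts at c as the scalar υ(c), so this scalar commutes with δ + cθ. -/
theorem Unramified.upsilon_mem (hc : Unramified δ c) : upsilon δ c ∈ δ.constants := by
  refine hc.mem_constants fun x => ?_
  have h := congrArg (fun p => ev δ c p x)
    (Subring.mem_center_iff.mp (centralZ_mem_center (δ := δ)) X)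
  simp only [map_mul, Module.End.mul_apply, ev_centralZ, ev_C, ev_X] at h
  exact h

theorem place_mem_center {z : K} (hz : z ∈ δ.constants) :
    place δ z ∈ Subring.center (OrePoly δ) :=
  sub_mem centralZ_mem_center (C_mem_center hz)

/-- The kernel of `ev_c` is generated by `Z - υ(c)`. -/
theorem Unramified.dvd_of_ev_eq_zero (hc : Unramified δ c) {p : OrePoly δ} (hp : ev δ c p = 0) :
    ∃ q, p = q * place δ (upsilon δ c) := by
  obtain ⟨hm, hd⟩ := place_monic hc.not_trivial (upsilon δ c)
  obtain ⟨R, hR, Q, rfl⟩ := exists_rightDiv p hm.ne_zero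
  rw [hd] at hR
  have hsurj : Function.Surjective
      ((evLin δ c).domRestrict (degreeLT δ (finrank δ.constants K))) := fun T => by
    obtain ⟨R, hR, h⟩ := hc.exists_mem_degreeLT_ev_eq hm.ne_zero hd (ev_place c) T
    exact ⟨⟨R, hR⟩, h⟩
  -- Remainders modulo N and End_F(K) both have dimension s over K, so surjectivity forces
  -- injectivity on remainders.
  have hinj := (LinearMap.injective_iff_surjective_of_finrank_eq_finrank
    (by rw [finrank_degreeLT, finrank_linearMap_self])).mpr hsurj
  rw [map_add, map_mul, ev_place, mul_zero, zero_add] at hp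
  have : (⟨R, hR⟩ : degreeLT δ (finrank δ.constants K)) = 0 :=
    (injective_iff_map_eq_zero _).mp hinj _ hp
  have hR0 : R = 0 := congrArg Subtype.val this
  exact ⟨Q, by rw [hR0, add_zero]⟩

end Eval

end OrePoly

/-! ### Chinese remainders, vanishing polynomials and the Goppa denominator -/

namespace OrePoly

open Module

variable {K : Type*} [Field K] {θ : K →+* K} {δ : SkewDerivation θ}

section Family

variable {m : ℕ} {c : Fin m → K} {V : Fin m → Submodule δ.constants K}

theorem IsVanishing.ne_zero {D' : OrePoly δ} (h : IsVanishing δ c V D') : D' ≠ 0 := h.monic.ne_zero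

variable [FiniteDimensional δ.constants K]

theorem ev_place_eq (c z : K) : ev δ c (place δ z) = ev δ c (C (upsilon δ c - z)) := by
  rw [place, map_sub, ev_centralZ, map_sub, map_sub]

/-- The product of the `N_j` with `j ≠ i`. -/
theorem exists_cofactor (hc : ∀ i, Unramified δ (c i))
    (hυ : Function.Injective fun i => upsilon δ (c i)) (i : Fin m) :
    ∃ S ∈ Subring.center (OrePoly δ), modulus δ c = place δ (upsilon δ (c i)) * S ∧
      (∃ l : K, l ≠ 0 ∧ ev δ (c i) S = ev δ (c i) (C l)) ∧ ∀ j ≠ i, ev δ (c j) S = 0 := by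
  classical
  let N : Fin m → Subring.center (OrePoly δ) := fun j =>
    ⟨place δ (upsilon δ (c j)), place_mem_center (hc j).upsilon_mem⟩
  have hN : modulus δ c = ((∏ j, N j : Subring.center (OrePoly δ)) : OrePoly δ) := by
    rw [modulus, ← List.prod_ofFn, ← Subring.subtype_apply, map_list_prod, List.map_ofFn]
    rfl
  refine ⟨_, (∏ j ∈ Finset.univ.erase i, N j).2, ?_, ?_, fun j hj => ?_⟩
  · rw [hN, ← Finset.mul_prod_erase _ _ (Finset.mem_univ i), Subring.coe_mul]
  -- N_j acts at c_i as the scalar z_i - z_j, which is nonzero for j ≠ i.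
  · have key : ∀ s : Finset (Fin m), i ∉ s → ∃ l : K, l ≠ 0 ∧
        ev δ (c i) ((∏ j ∈ s, N j : Subring.center (OrePoly δ)) : OrePoly δ)
          = ev δ (c i) (C l) := by
      intro s
      induction s using Finset.induction_on with
      | empty => exact fun _ => ⟨1, one_ne_zero, by simp⟩
      | insert j s hj ih =>
        intro hi
        rw [Finset.mem_insert, not_or] at hi
        obtain ⟨l, hl, hl'⟩ := ih hi.2
        refine ⟨(upsilon δ (c i) - upsilon δ (c j)) * l,
          mul_ne_zero (sub_ne_zero.mpr fun h => hi.1 (hυ h)) hl, ?_⟩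
        rw [Finset.prod_insert hj, Subring.coe_mul, map_mul, hl', ev_place_eq, map_mul, map_mul]
    exact key _ (Finset.notMem_erase i _)
  · rw [← Finset.mul_prod_erase _ _ (Finset.mem_erase.mpr ⟨hj, Finset.mem_univ j⟩),
      Subring.coe_mul, map_mul, ev_place, zero_mul]

/-- Chinese remainder theorem for the evaluation maps. -/
theorem exists_ev_eq (hc : ∀ i, Unramified δ (c i))
    (hυ : Function.Injective fun i => upsilon δ (c i))
    (T : ∀ _ : Fin m, Module.End δ.constants K) : ∃ P : OrePoly δ, ∀ i, ev δ (c i) P = T i := by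
  choose S _ _ hl hS using exists_cofactor hc hυ
  choose l hl0 hl using hl
  choose P hP using fun i => (hc i).ev_surjective (T i)
  refine ⟨∑ i, C (l i)⁻¹ * S i * P i, fun i => ?_⟩
  rw [map_sum, Finset.sum_eq_single i]
  · rw [map_mul, map_mul, hl, ← map_mul, ← map_mul C, inv_mul_cancel₀ (hl0 i), map_one, map_one,
      one_mul, hP]
  · intro j _ hj
    rw [map_mul, map_mul, hS j i hj.symm, mul_zero, zero_mul]
  · simp

/-- The left ideal of the Ore polynomials vanishing on all `V_i` is generated by a polynomial of
degree `∑ dim V_i`. -/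
theorem exists_isVanishing_and_degree (hc : ∀ i, Unramified δ (c i))
    (hυ : Function.Injective fun i => upsilon δ (c i)) (V : Fin m → Submodule δ.constants K) :
    (∃ D' : OrePoly δ, IsVanishing δ c V D') ∧
      ∀ q : OrePoly δ, (∀ i, ∀ x ∈ V i, ev δ (c i) q x = 0) →
        q.degree < ((∑ i, finrank δ.constants (V i) : ℕ) : WithBot ℕ) → q = 0 := by
  set n := ∑ i, finrank δ.constants (V i) with hn
  have (i : Fin m) : Module.Finite K (V i →ₗ[δ.constants] K) :=
    Module.Finite.linearMap δ.constants K (V i) K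
  have : Module.Finite K (∀ i, V i →ₗ[δ.constants] K) := Module.Finite.pi
  have hfin : finrank K (∀ i, V i →ₗ[δ.constants] K) = n := by
    rw [finrank_pi_fintype, hn]
    exact Finset.sum_congr rfl fun i _ => finrank_linearMap_self _ _ _
  have hker : ∀ q : OrePoly δ, evTuple δ c V q = 0 ↔ ∀ i, ∀ x ∈ V i, ev δ (c i) q x = 0 := by
    intro q
    rw [funext_iff]
    refine forall_congr' fun i => ?_
    rw [LinearMap.ext_iff, Subtype.forall]
    rfl
  obtain ⟨p₀, hp₀, hp₀'⟩ : ∃ p : OrePoly δ, p ≠ 0 ∧ evTuple δ c V p = 0 := by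
    by_contra hcon
    push Not at hcon
    have hinj : Function.Injective ((evTuple δ c V).domRestrict (degreeLT δ (n + 1))) := by
      rw [injective_iff_map_eq_zero]
      rintro ⟨p, hp⟩ h
      by_contra h0
      exact hcon p (fun h => h0 (Subtype.ext h)) h
    have := LinearMap.finrank_le_finrank_of_injective hinj
    rw [finrank_degreeLT, hfin] at this
    omega
  set A := {p : OrePoly δ | p ≠ 0 ∧ evTuple δ c V p = 0} with hA
  have hne : A.Nonempty := ⟨p₀, hp₀, hp₀'⟩
  obtain ⟨hq0, hq⟩ : degree_wf.min A hne ∈ A := degree_wf.min_mem A hne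
  have hmin : ∀ r : OrePoly δ, evTuple δ c V r = 0 → r.degree < (degree_wf.min A hne).degree →
      r = 0 := by
    intro r hr hlt
    by_contra h0
    exact degree_wf.not_lt_min A (x := r) ⟨h0, hr⟩ hlt
  obtain ⟨l, -, hlm, hld⟩ := exists_monic_smul hq0
  set q := degree_wf.min A hne
  obtain ⟨d, hd⟩ := exists_degree_eq hq0
  rw [hd] at hmin
  -- Injective by minimality of q. Surjective because a tuple extends to all of K, is realized by
  -- the Chinese remainder theorem, and may be reduced modulo q. Comparing dimensions gives d = n.
  have hbij : Function.Bijective ((evTuple δ c V).domRestrict (degreeLT δ d)) := by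
    refine ⟨?_, fun T => ?_⟩
    · rw [injective_iff_map_eq_zero]
      rintro ⟨p, hp⟩ h
      exact Subtype.ext (hmin p h hp)
    · choose T' hT' using fun i => LinearMap.exists_extend (T i)
      obtain ⟨P, hP⟩ := exists_ev_eq hc hυ T'
      obtain ⟨R, hR, Q, rfl⟩ := exists_rightDiv P hq0
      rw [hd] at hR
      refine ⟨⟨R, hR⟩, funext fun i => LinearMap.ext fun x => ?_⟩
      rw [← hT' i, ← hP i, map_add, map_mul]
      change ev δ (c i) R x = ev δ (c i) Q (ev δ (c i) q x) + ev δ (c i) R x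
      rw [(hker q).mp hq i x x.2, map_zero, zero_add]
  have hdn : d = n := by
    have := (LinearEquiv.ofBijective _ hbij).finrank_eq
    rwa [finrank_degreeLT, hfin] at this
  subst hdn
  refine ⟨⟨l • q, hlm, by rw [hld, hd], (hker _).mp ?_⟩, fun r hr => hmin r ((hker r).mpr hr)⟩
  rw [map_smul, hq, smul_zero]

theorem IsVanishing.unique (hc : ∀ i, Unramified δ (c i))
    (hυ : Function.Injective fun i => upsilon δ (c i)) {D₁ D₂ : OrePoly δ}
    (h₁ : IsVanishing δ c V D₁) (h₂ : IsVanishing δ c V D₂) : D₁ = D₂ := by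
  rw [← sub_eq_zero]
  refine (exists_isVanishing_and_degree hc hυ V).2 _ (fun i x hx => ?_) ?_
  · rw [map_sub, LinearMap.sub_apply, h₁.vanish i x hx, h₂.vanish i x hx, sub_zero]
  · rw [degree_lt_iff]
    intro j hj
    rw [coeff_sub]
    rcases hj.eq_or_lt with rfl | hj
    · rw [h₁.monic.coeff_eq_one h₁.degree_eq, h₂.monic.coeff_eq_one h₂.degree_eq, sub_self]
    · rw [coeff_eq_zero_of_degree_eq h₁.degree_eq hj, coeff_eq_zero_of_degree_eq h₂.degree_eq hj,
        sub_zero]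

theorem IsVanishing.exists_eq_mul (hc : ∀ i, Unramified δ (c i))
    (hυ : Function.Injective fun i => upsilon δ (c i)) {D' : OrePoly δ}
    (h : IsVanishing δ c V D') {p : OrePoly δ} (hp : ∀ i, ∀ x ∈ V i, ev δ (c i) p x = 0) :
    ∃ q, p = q * D' := by
  obtain ⟨R, hR, Q, rfl⟩ := exists_rightDiv p h.ne_zero
  rw [h.degree_eq] at hR
  have : R = 0 := (exists_isVanishing_and_degree hc hυ V).2 R (fun i x hx => by
    have := hp i x hx
    rwa [map_add, map_mul, LinearMap.add_apply, Module.End.mul_apply, h.vanish i x hx, map_zero,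
      zero_add] at this) hR
  exact ⟨Q, by rw [this, add_zero]⟩

/-- If the kernel at c_i were larger than V_i, then D' would vanish on the family with V_i replaced
by that kernel. Its degree would be too small for this unless D' = 0. -/
theorem IsVanishing.ker_ev (hc : ∀ i, Unramified δ (c i))
    (hυ : Function.Injective fun i => upsilon δ (c i)) {D' : OrePoly δ}
    (h : IsVanishing δ c V D') (i : Fin m) : LinearMap.ker (ev δ (c i) D') = V i := by
  classical
  have hle : V i ≤ LinearMap.ker (ev δ (c i) D') := fun x hx => h.vanish i x hx
  refine (eq_of_le_of_not_lt hle fun hlt => h.ne_zero ?_).symm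
  refine (exists_isVanishing_and_degree hc hυ
    (Function.update V i (LinearMap.ker (ev δ (c i) D')))).2 D' (fun j x hx => ?_) ?_
  · by_cases hj : j = i
    · subst hj; rw [Function.update_self] at hx; exact hx
    · rw [Function.update_of_ne hj] at hx; exact h.vanish j x hx
  · rw [h.degree_eq, Nat.cast_lt]
    refine Finset.sum_lt_sum (fun j _ => ?_) ⟨i, Finset.mem_univ i, ?_⟩
    · by_cases hj : j = i
      · subst hj; rw [Function.update_self]; exact Submodule.finrank_mono hle
      · rw [Function.update_of_ne hj]
    · rw [Function.update_self]; exact Submodule.finrank_lt_finrank_of_lt hlt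

theorem modulus_mem_center (hc : ∀ i, Unramified δ (c i)) :
    modulus δ c ∈ Subring.center (OrePoly δ) := by
  refine list_prod_mem fun x hx => ?_
  obtain ⟨i, rfl⟩ := List.mem_ofFn.mp hx
  exact place_mem_center (hc i).upsilon_mem

/-- N vanishes at every c_i, so D' divides it on the right: N = D D'. Centrality of N and
cancellation of D' then give D' D = N as well. -/
theorem existsUnique_goppaDenominator (hc : ∀ i, Unramified δ (c i))
    (hυ : Function.Injective fun i => upsilon δ (c i)) (V : Fin m → Submodule δ.constants K) :
    ∃! D : OrePoly δ, IsGoppaDenominator δ c V D := by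
  obtain ⟨D', hD'⟩ := (exists_isVanishing_and_degree hc hυ V).1
  obtain ⟨D, hD⟩ := hD'.exists_eq_mul hc hυ (p := modulus δ c) fun i x _ => by
    obtain ⟨S, -, hS, -⟩ := exists_cofactor hc hυ i
    rw [hS, map_mul, ev_place, zero_mul, LinearMap.zero_apply]
  have hD2 : D' * D = modulus δ c := by
    refine mul_right_cancel₀ hD'.ne_zero ?_
    rw [mul_assoc, ← hD]
    exact Subring.mem_center_iff.mp (modulus_mem_center hc) D'
  refine ⟨D, ⟨D', hD', hD2, hD.symm⟩, ?_⟩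
  rintro E ⟨D'', hD'', -, hE⟩
  rw [hD''.unique hc hυ hD'] at hE
  exact mul_right_cancel₀ hD'.ne_zero (hE.trans hD)

end Family

end OrePoly

/-! ### Values and residues of fractions with a central denominator -/

namespace OrePoly

open Module

variable {K : Type*} [Field K] {θ : K →+* K} {δ : SkewDerivation θ}

theorem proj_surjective (z : K) (r : ℕ) : Function.Surjective (proj δ z r) :=
  Quotient.mk_surjective

theorem toFrac_injective (δ : SkewDerivation θ) : Function.Injective (toFrac δ) :=
  OreLocalization.numeratorHom_inj inf_le_left

theorem toFrac_ne_zero {p : OrePoly δ} (hp : p ≠ 0) : toFrac δ p ≠ 0 :=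
  (map_ne_zero_iff _ (toFrac_injective δ)).mpr hp

section Taylor

variable {z : K} {TS : FracField δ →+* LaurentSeries (ResidueRing δ z)}

/-- A fraction `B S⁻¹` with `S` central and invertible at `z` has no pole at `z`, and its value is
`S⁻¹ B`. -/
theorem IsTaylorExpansion.noPole_and_value (hTS : IsTaylorExpansion δ z TS) {g : FracField δ}
    {S B : OrePoly δ} (hS : S ∈ Subring.center (OrePoly δ)) (hg : g * toFrac δ S = toFrac δ B)
    (hu : IsUnit (proj δ z 1 S)) :
    NoPole TS g ∧ proj δ z 1 S * value TS g = proj δ z 1 B := by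
  obtain ⟨e, he, hT⟩ := hTS
  have hcc : ∀ p : OrePoly δ, PowerSeries.constantCoeff (e (toCompletion δ z p)) = proj δ z 1 p :=
    fun p => he.constantCoeff_eq _
  obtain ⟨u, hu⟩ := hu
  -- The series of S has an invertible constant coefficient, so the expansion of g = B S⁻¹ is
  -- already a power series.
  set I := PowerSeries.invOfUnit (e (toCompletion δ z S)) u
  have hI : e (toCompletion δ z S) * I = 1 :=
    PowerSeries.mul_invOfUnit _ _ (by rw [hcc, hu])
  have hTg : TS g = HahnSeries.ofPowerSeries ℤ _ (e (toCompletion δ z B) * I) := by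
    rw [map_mul, ← hT B, ← hg, map_mul, hT S, mul_assoc, ← map_mul, hI, map_one, mul_one]
  refine ⟨fun j hj => ?_, ?_⟩
  · rw [hTg, PowerSeries.coeff_coe, if_pos hj]
  · have hv : value TS g = proj δ z 1 B * ↑u⁻¹ := by
      rw [value, hTg, ← Nat.cast_zero, HahnSeries.ofPowerSeries_apply_coeff,
        PowerSeries.coeff_zero_eq_constantCoeff_apply, map_mul, hcc,
        PowerSeries.constantCoeff_invOfUnit]
    have hcomm : proj δ z 1 S * proj δ z 1 B = proj δ z 1 B * proj δ z 1 S := by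
      rw [← map_mul, ← map_mul, Subring.mem_center_iff.mp hS]
    rw [hv, ← mul_assoc, hcomm, ← hu, mul_assoc, Units.mul_inv, mul_one]

/-- N expands to T, so multiplying by it moves the coefficient of T⁻¹ to the constant place. -/
theorem IsTaylorExpansion.sres_eq_value (hTS : IsTaylorExpansion δ z TS) (f : FracField δ) :
    sres TS f = value TS (f * toFrac δ (place δ z)) := by
  obtain ⟨e, he, hT⟩ := hTS
  rw [value, map_mul, hT, he.map_place, HahnSeries.ofPowerSeries_X,
    show (0 : ℤ) = -1 + 1 by norm_num, HahnSeries.coeff_mul_single_add, mul_one, sres]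

end Taylor

section Residue

theorem proj_place (z : K) : proj δ z 1 (place δ z) = 0 := by
  rw [← map_zero (proj δ z 1)]
  refine Quotient.sound ?_
  change (placeIdeal δ z 1).ringCon _ _
  rw [← TwoSidedIdeal.mem_iff]
  exact TwoSidedIdeal.subset_span (by rw [pow_one]; rfl)

theorem ev_X_add_twist (hθ : θ ≠ RingHom.id K) (c x : K) :
    ev δ c (X + C (twist δ)) x = (twist δ + c) * θ x := by
  rw [map_add, LinearMap.add_apply, ev_X, ev_C, pseudoEnd_apply, twist_spec hθ]
  ring

/-- X + a acts as (a + c)θ. If a + c = 0, then δ + cθ would be multiplication by -a, against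
unramifiedness. -/
theorem Unramified.ev_X_add_twist_pow_injective {c : K} (hc : Unramified δ c)
    (hθ : θ ≠ RingHom.id K) (e : ℕ) :
    Function.Injective (ev δ c ((X + C (twist δ)) ^ e)) := by
  have h0 : twist δ + c ≠ 0 := fun h => hc ⟨-twist δ, fun x => by
    rw [twist_spec hθ]; linear_combination θ x * h⟩
  rw [map_pow, Module.End.coe_pow]
  refine Function.Injective.iterate (fun x y hxy => ?_) e
  rw [ev_X_add_twist hθ, ev_X_add_twist hθ] at hxy
  exact θ.injective (mul_left_cancel₀ h0 hxy)

variable [FiniteDimensional δ.constants K]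

theorem evRes_proj (c : K) (P : OrePoly δ) : evRes δ c (proj δ (upsilon δ c) 1 P) = ev δ c P := rfl

/-- Identifies the residue ring with End_F(K), so identities between residue classes can be checked
on operators. -/
theorem Unramified.evRes_bijective {c : K} (hc : Unramified δ c) :
    Function.Bijective (evRes δ c) := by
  refine ⟨?_, fun T => ?_⟩
  · rw [injective_iff_map_eq_zero]
    intro x hx
    obtain ⟨P, rfl⟩ := proj_surjective _ _ x
    obtain ⟨q, rfl⟩ := hc.dvd_of_ev_eq_zero hx
    rw [map_mul, proj_place, mul_zero]
  · obtain ⟨P, rfl⟩ := hc.ev_surjective T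
    exact ⟨proj δ _ 1 P, rfl⟩

theorem Unramified.upsilon_ne_zero {c : K} (hc : Unramified δ c) (hθ : θ ≠ RingHom.id K) :
    upsilon δ c ≠ 0 := by
  intro h
  have h1 : ev δ c (centralZ δ) 1 = 0 := by rw [ev_centralZ, h, ev_C, zero_mul]
  rw [show centralZ δ = (X + C (twist δ)) ^ finrank δ.constants K from if_neg hθ] at h1
  exact one_ne_zero (hc.ev_X_add_twist_pow_injective hθ _ (h1.trans (map_zero _).symm))

variable {m : ℕ} {c : Fin m → K} {V : Fin m → Submodule δ.constants K}

/-- With N = N_i S_i = D D', one has D⁻¹ N_i S_i = D'. If θ ≠ id, the central power of Z is cleared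
too, which is harmless since υ(c_i) ≠ 0. The remaining left factor, a power of X + a, is injective
and does not enlarge the kernel. -/
theorem IsGoppaDenominator.exists_central_multiple (hc : ∀ i, Unramified δ (c i))
    (hυ : Function.Injective fun i => upsilon δ (c i)) {D : OrePoly δ}
    (hD : IsGoppaDenominator δ c V D) (k : ℕ) (i : Fin m) :
    ∃ S ∈ Subring.center (OrePoly δ), ∃ B : OrePoly δ,
      goppaPN k c V D i * toFrac δ S = toFrac δ B ∧
      (∃ l : K, l ≠ 0 ∧ ev δ (c i) S = ev δ (c i) (C l)) ∧
      LinearMap.ker (ev δ (c i) B) = V i := by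
  obtain ⟨D', hD', -, hDD⟩ := hD
  obtain ⟨S, hS, hNS, ⟨l, hl, hSl⟩, -⟩ := exists_cofactor hc hυ i
  have hmod : modulus δ c ≠ 0 := by
    refine List.prod_ne_zero fun h0 => ?_
    obtain ⟨j, hj⟩ := List.mem_ofFn.mp h0
    exact (place_monic (hc i).not_trivial _).1.ne_zero hj
  have hD0 : toFrac δ D ≠ 0 := toFrac_ne_zero fun h => hmod (by rw [← hDD, h, zero_mul])
  have key : (toFrac δ D)⁻¹ * toFrac δ (place δ (upsilon δ (c i))) * toFrac δ S = toFrac δ D' := by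
    rw [mul_assoc, ← map_mul, ← hNS, ← hDD, map_mul, inv_mul_cancel_left₀ hD0]
  by_cases hθ : θ = RingHom.id K
  · refine ⟨S, hS, D', ?_, ⟨l, hl, hSl⟩, hD'.ker_ev hc hυ i⟩
    rw [goppaPN, goppaP, if_pos hθ, key]
  · have hZ := centralZ_mem_center (δ := δ)
    have hZ0 : toFrac δ (centralZ δ) ≠ 0 :=
      toFrac_ne_zero (centralZ_monic (hc i).not_trivial).1.ne_zero
    set e := ∑ i, finrank δ.constants (K ⧸ V i) - k
    refine ⟨S * centralZ δ ^ (m + 1), mul_mem hS (pow_mem hZ _),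
      (X + C (twist δ)) ^ e * D', ?_, ⟨l * upsilon δ (c i) ^ (m + 1),
        mul_ne_zero hl (pow_ne_zero _ ((hc i).upsilon_ne_zero hθ)), ?_⟩, ?_⟩
    · have hcomm : toFrac δ D' * toFrac δ (centralZ δ) ^ (m + 1)
          = toFrac δ (centralZ δ) ^ (m + 1) * toFrac δ D' := by
        rw [← map_pow, ← map_mul, ← map_mul, Subring.mem_center_iff.mp (pow_mem hZ (m + 1))]
      have hcomm' : toFrac δ (X + C (twist δ)) ^ e * toFrac δ (centralZ δ) ^ (m + 1)
          = toFrac δ (centralZ δ) ^ (m + 1) * toFrac δ (X + C (twist δ)) ^ e := by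
        rw [← map_pow, ← map_pow, ← map_mul, ← map_mul,
          Subring.mem_center_iff.mp (pow_mem hZ (m + 1))]
      rw [goppaPN, goppaP, if_neg hθ, map_mul, map_pow, map_mul, map_pow]
      calc _ = (toFrac δ (centralZ δ))⁻¹ ^ (m + 1) * toFrac δ (X + C (twist δ)) ^ e *
            ((toFrac δ D)⁻¹ * toFrac δ (place δ (upsilon δ (c i))) * toFrac δ S) *
              toFrac δ (centralZ δ) ^ (m + 1) := by simp only [mul_assoc]; rfl
        _ = (toFrac δ (centralZ δ))⁻¹ ^ (m + 1) * toFrac δ (centralZ δ) ^ (m + 1) *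
            (toFrac δ (X + C (twist δ)) ^ e * toFrac δ D') := by
          rw [key, mul_assoc, hcomm, mul_assoc, ← mul_assoc _ _ (toFrac δ D'), hcomm']
          simp only [mul_assoc]
        _ = _ := by rw [inv_pow, inv_mul_cancel₀ (pow_ne_zero _ hZ0), one_mul]
    · rw [map_mul, hSl, map_pow, ev_centralZ, ← map_pow, ← map_mul, map_mul C, map_pow]
    · rw [map_mul, Module.End.mul_eq_comp, LinearMap.ker_comp_of_ker_eq_bot, hD'.ker_ev hc hυ i]
      exact LinearMap.ker_eq_bot.mpr ((hc i).ev_X_add_twist_pow_injective hθ e)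

/-- The value at `z_i` of `P N_i` and the residues at `z_i` of the `Q P`, for all Taylor
expansions. -/
theorem IsGoppaDenominator.exists_value (hc : ∀ i, Unramified δ (c i))
    (hυ : Function.Injective fun i => upsilon δ (c i)) {D : OrePoly δ}
    (hD : IsGoppaDenominator δ c V D) (k : ℕ) (i : Fin m) :
    ∃ v : ResidueRing δ (upsilon δ (c i)), LinearMap.ker (evRes δ (c i) v) = V i ∧
      ∀ TS, IsTaylorExpansion δ (upsilon δ (c i)) TS →
        NoPole TS (goppaPN k c V D i) ∧ value TS (goppaPN k c V D i) = v ∧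
        ∀ Q : OrePoly δ, sres TS (toFrac δ Q * goppaP δ k V D) = proj δ _ 1 Q * v := by
  obtain ⟨S, hS, B, hB, ⟨l, hl, hSl⟩, hker⟩ := hD.exists_central_multiple hc hυ k i
  have hSl' : proj δ (upsilon δ (c i)) 1 S = proj δ _ 1 (C l) :=
    (hc i).evRes_bijective.1 hSl
  have hu : IsUnit (proj δ (upsilon δ (c i)) 1 S) := by
    rw [hSl']
    exact (hl.isUnit.map C).map _
  obtain ⟨u, hu'⟩ := id hu
  have huv : ∀ v, proj δ (upsilon δ (c i)) 1 S * v = proj δ _ 1 B → v = ↑u⁻¹ * proj δ _ 1 B :=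
    fun v hv => by rw [← hv, ← hu', Units.inv_mul_cancel_left]
  -- The class S⁻¹B, defined without any Taylor expansion. Since S acts at c_i as a nonzero scalar,
  -- the kernel is that of B.
  refine ⟨↑u⁻¹ * proj δ (upsilon δ (c i)) 1 B, ?_, fun TS hTS => ?_⟩
  · rw [← hker]
    ext x
    have h1 : ev δ (c i) B x = l * evRes δ (c i) (↑u⁻¹ * proj δ (upsilon δ (c i)) 1 B) x := by
      rw [← ev_C (δ := δ) (c i), ← evRes_proj (c i) (C l), ← hSl', ← hu', ← Module.End.mul_apply,
        ← map_mul, Units.mul_inv_cancel_left, evRes_proj]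
    rw [LinearMap.mem_ker, LinearMap.mem_ker, h1, mul_eq_zero, or_iff_right hl]
  · obtain ⟨h1, h2⟩ := hTS.noPole_and_value hS hB hu
    refine ⟨h1, huv _ h2, fun Q => ?_⟩
    -- Q P N_i keeps the same central denominator, with numerator Q B, so its value is computed in
    -- the same way.
    have hQ : toFrac δ Q * goppaPN k c V D i * toFrac δ S = toFrac δ (Q * B) := by
      rw [mul_assoc, hB, map_mul]
    obtain ⟨-, h3⟩ := hTS.noPole_and_value hS hQ hu
    rw [hTS.sres_eq_value, mul_assoc]
    change value TS (toFrac δ Q * goppaPN k c V D i) = _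
    have hcomm : proj δ (upsilon δ (c i)) 1 S * proj δ _ 1 Q = proj δ _ 1 Q * proj δ _ 1 S := by
      rw [← map_mul, ← map_mul, Subring.mem_center_iff.mp hS]
    refine hu.mul_left_cancel ?_
    rw [h3, ← mul_assoc, hcomm, map_mul, mul_assoc, ← hu', Units.mul_inv_cancel_left]

end Residue

end OrePoly

/-! ### Deformation of the evaluation map and reparametrization -/

/-- A polynomial with a simple root at `0` has a right inverse for the composition among power
series. -/
theorem PowerSeries.exists_aeval_eq_X {F : Type*} [Field F] (q : Polynomial F)
    (h0 : q.coeff 0 = 0) (h1 : q.coeff 1 ≠ 0) :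
    ∃ τ : PowerSeries F, PowerSeries.constantCoeff τ = 0 ∧
      Polynomial.aeval τ q = PowerSeries.X := by
  obtain ⟨g, hg⟩ : ∃ g : Polynomial F,
      q = Polynomial.X * (Polynomial.C (q.coeff 1) + Polynomial.X * g) := by
    refine ⟨q.divX.divX, ?_⟩
    conv_lhs => rw [← Polynomial.X_mul_divX_add q, h0, Polynomial.C_0, add_zero,
      ← Polynomial.X_mul_divX_add q.divX, Polynomial.coeff_divX]
    ring
  set a := q.coeff 1
  -- With q = X(a + X g), the equation q(τ) = T says that τ is a fixed point of this map, which
  -- gains one order of T-adic precision at each application.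
  let Φ : PowerSeries F → PowerSeries F := fun τ =>
    PowerSeries.C a⁻¹ * (PowerSeries.X - τ ^ 2 * Polynomial.aeval τ g)
  have hX : ∀ τ, PowerSeries.X ∣ τ → (PowerSeries.X : PowerSeries F) ∣ Φ τ := fun τ h =>
    Dvd.dvd.mul_left (dvd_sub dvd_rfl (Dvd.dvd.mul_right (dvd_pow h two_ne_zero) _)) _
  have hΦ : ∀ (n : ℕ) (τ σ : PowerSeries F), PowerSeries.X ∣ τ → PowerSeries.X ∣ σ →
      PowerSeries.X ^ n ∣ τ - σ → PowerSeries.X ^ (n + 1) ∣ Φ τ - Φ σ := by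
    intro n τ σ hτ hσ h
    have hd : τ - σ ∣ Polynomial.aeval τ g - Polynomial.aeval σ g := by
      have := Polynomial.sub_dvd_eval_sub τ σ (g.map (algebraMap F (PowerSeries F)))
      simpa only [Polynomial.eval_map_algebraMap] using this
    have : Φ τ - Φ σ = PowerSeries.C a⁻¹ * -((τ - σ) * ((τ + σ) * Polynomial.aeval τ g)
        + (Polynomial.aeval τ g - Polynomial.aeval σ g) * (σ * σ)) := by
      simp only [Φ]; ring
    rw [this, pow_succ]
    refine Dvd.dvd.mul_left ((dvd_add (mul_dvd_mul h ?_) (mul_dvd_mul (h.trans hd) ?_)).neg_right) _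
    · exact Dvd.dvd.mul_right (dvd_add hτ hσ) _
    · exact Dvd.dvd.mul_right hσ _
  let t : ℕ → PowerSeries F := fun n => Φ^[n] 0
  have ht : ∀ n, t (n + 1) = Φ (t n) := fun n => Function.iterate_succ_apply' _ _ _
  have htX : ∀ n, PowerSeries.X ∣ t n := by
    intro n
    induction n with
    | zero => exact dvd_zero _
    | succ n ih => rw [ht]; exact hX _ ih
  have hstep : ∀ n, PowerSeries.X ^ n ∣ t (n + 1) - t n := by
    intro n
    induction n with
    | zero => rw [pow_zero]; exact one_dvd _
    | succ n ih => rw [ht, ht n]; rw [ht n] at ih; exact hΦ n _ _ (ht n ▸ htX (n + 1)) (htX n) ih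
  have hlim : ∀ n m, n ≤ m → PowerSeries.X ^ n ∣ t m - t n := by
    intro n m hnm
    induction m, hnm using Nat.le_induction with
    | base => rw [sub_self]; exact dvd_zero _
    | succ m hm ih =>
      rw [← sub_add_sub_cancel _ (t m)]
      exact dvd_add ((pow_dvd_pow _ hm).trans (hstep m)) ih
  -- The iterates agree modulo Tⁿ from index n on, so the coefficient of Tⁿ is final at index n + 1.
  let τ : PowerSeries F := PowerSeries.mk fun n => PowerSeries.coeff n (t (n + 1))
  have hτ : ∀ n, PowerSeries.X ^ n ∣ τ - t n := by
    intro n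
    rw [PowerSeries.X_pow_dvd_iff]
    intro j hj
    have := PowerSeries.X_pow_dvd_iff.mp (hlim (j + 1) n hj) j (Nat.lt_succ_self j)
    rw [map_sub, sub_eq_zero] at this
    rw [map_sub, PowerSeries.coeff_mk, this, sub_self]
  have hτX : PowerSeries.X ∣ τ := by
    have := dvd_add (hτ 1) ((pow_one (PowerSeries.X : PowerSeries F)).symm ▸ htX 1)
    rwa [sub_add_cancel, pow_one] at this
  have hfix : Φ τ = τ := by
    rw [← sub_eq_zero]
    ext n
    have h : PowerSeries.X ^ (n + 1) ∣ Φ τ - τ := by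
      have h2 := dvd_sub (hΦ n _ _ hτX (htX n) (hτ n)) (hτ (n + 1))
      rwa [ht, sub_sub_sub_cancel_right] at h2
    rw [PowerSeries.X_pow_dvd_iff.mp h n (Nat.lt_succ_self n), map_zero]
  refine ⟨τ, PowerSeries.X_dvd_iff.mp hτX, ?_⟩
  have hmul : PowerSeries.C a * τ = PowerSeries.X - τ ^ 2 * Polynomial.aeval τ g := by
    conv_lhs => rw [← hfix]
    simp only [Φ]
    rw [← mul_assoc, ← map_mul, mul_inv_cancel₀ h1, map_one, one_mul]
  rw [hg, map_mul, map_add, map_mul, Polynomial.aeval_X, Polynomial.aeval_C,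
    show algebraMap F (PowerSeries F) a = PowerSeries.C a from rfl]
  linear_combination hmul

namespace OrePoly

open Module

variable {K : Type*} [Field K] {θ : K →+* K} {δ : SkewDerivation θ}

theorem ringHom_ext {S : Type*} [Ring S] {f g : OrePoly δ →+* S} (hC : ∀ a, f (C a) = g (C a))
    (hX : f X = g X) : f = g := by
  ext p
  induction p using OrePoly.induction with
  | hadd p q hp hq => rw [map_add, map_add, hp, hq]
  | hmon n a => rw [monomial_eq, map_mul, map_mul, map_pow, map_pow, hC, hX]

/-- The universal property of the Ore polynomials. -/
theorem exists_lift {S : Type*} [Ring S] (i : K →+* S) (x : S)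
    (h : ∀ a, x * i a = i (θ a) * x + i (δ a)) :
    ∃ f : OrePoly δ →+* S, (∀ a, f (C a) = i a) ∧ f X = x := by
  -- With K acting through i, the hypothesis says that left multiplication by x is pseudo-linear on
  -- S. The lift is p ↦ p(u)(1).
  let _ : Module K S := Module.compHom S i
  have hsmul : ∀ (a : K) (y : S), a • y = i a * y := fun _ _ => rfl
  let u : Module.End ℤ S := LinearMap.mulLeft ℤ x
  have hu : ∀ (a : K) (y : S), u (a • y) = θ a • u y + δ a • y := fun a y => by
    simp only [hsmul, u, LinearMap.mulLeft_apply, ← mul_assoc, h, add_mul]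
  have hpow : ∀ (n : ℕ) (y : S), (u ^ n) y = x ^ n * y := fun n y => by
    simp only [u, LinearMap.pow_mulLeft, LinearMap.mulLeft_apply]
  -- p(u) is left multiplication by its value at 1, so composition of operators becomes
  -- multiplication in S.
  have hright : ∀ (p : OrePoly δ) (y : S), evalEnd u p y = evalEnd u p 1 * y := by
    intro p y
    induction p using OrePoly.induction with
    | hadd p q hp hq =>
      rw [evalEnd_add, LinearMap.add_apply, LinearMap.add_apply, hp, hq, add_mul]
    | hmon n a =>
      rw [evalEnd_monomial, LinearMap.smul_apply, LinearMap.smul_apply, hsmul, hsmul, hpow, hpow,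
        mul_one, mul_assoc]
  refine ⟨{ toFun := fun p => evalEnd u p 1
            map_one' := by rw [evalEnd_one]; rfl
            map_zero' := by rw [evalEnd_zero]; rfl
            map_add' := fun p q => by rw [evalEnd_add]; rfl
            map_mul' := fun p q => by
              rw [evalEnd_mul u hu, Module.End.mul_apply, hright] }, fun a => ?_, ?_⟩
  · change evalEnd u (monomial 0 a : OrePoly δ) 1 = _
    rw [evalEnd_monomial, LinearMap.smul_apply, hsmul, hpow, pow_zero, mul_one, mul_one]
  · change evalEnd u (monomial 1 1 : OrePoly δ) 1 = _
    rw [evalEnd_monomial, LinearMap.smul_apply, hsmul, hpow, pow_one, mul_one, map_one, one_mul]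

/-- `θ` as an `F`-linear map. -/
noncomputable def thetaEnd (δ : SkewDerivation θ) : Module.End δ.constants K where
  toFun := θ
  map_add' := map_add θ
  map_smul' a x := by
    simp only [Subfield.smul_def, smul_eq_mul, RingHom.id_apply, map_mul]
    rw [(SkewDerivation.mem_constants.mp a.2).1]

/-- An endomorphism commuting with the multiplications is a multiplication. -/
theorem eq_ev_C_of_comm (c : K) {w : Module.End δ.constants K}
    (h : ∀ a, w * ev δ c (C a) = ev δ c (C a) * w) : w = ev δ c (C (w 1)) := by
  ext x
  have := LinearMap.congr_fun (h x) 1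
  rw [Module.End.mul_apply, Module.End.mul_apply, ev_C, ev_C, mul_one] at this
  rw [this, ev_C, mul_comm]

variable [FiniteDimensional δ.constants K] {c : K}

/-- At c, both N and X - c kill 1, so the constant remainder is zero. If ev_c(Q) were zero, then Q =
q N, and cancelling the central N would give q (X - c) = 1, which is impossible since X - c kills 1.
-/
theorem Unramified.exists_cofactor_X_sub (hc : Unramified δ c) :
    ∃ Q : OrePoly δ, place δ (upsilon δ c) = Q * (X - C c) ∧ ev δ c Q ≠ 0 := by
  have h1 : (X - C c : OrePoly δ).coeff 1 = 1 := by
    rw [coeff_sub, coeff_X, coeff_C]; simp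
  have hd : (X - C c : OrePoly δ).degree = (1 : ℕ) :=
    (monic_of_coeff h1 fun i hi => by
      rw [coeff_sub, coeff_X, coeff_C, if_neg (by omega), if_neg (by omega), sub_zero]).2
  have hev : ev δ c (X - C c) 1 = 0 := by
    rw [map_sub, LinearMap.sub_apply, ev_X, pseudoEnd_apply, ev_C, δ.map_one_eq, map_one]
    ring
  obtain ⟨R, hR, Q, hQ⟩ := exists_rightDiv (place δ (upsilon δ c)) (B := X - C c) (by
    rintro h; rw [h, coeff_zero] at h1; exact zero_ne_one h1)
  rw [hd, degree_lt_iff] at hR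
  have hRC : R = C (R.coeff 0) := ext_coeff fun n => by
    rw [coeff_C]
    split_ifs with h
    · rw [h]
    · exact hR n (by omega)
  have hR0 : R = 0 := by
    have := congrArg (fun p => ev δ c p 1) hQ
    simp only [ev_place, map_add, map_mul, LinearMap.add_apply, Module.End.mul_apply, hev,
      LinearMap.zero_apply, map_zero, zero_add] at this
    rw [hRC, ev_C, mul_one] at this
    rw [hRC, ← this, map_zero]
  rw [hR0, add_zero] at hQ
  refine ⟨Q, hQ, fun hQ0 => ?_⟩
  obtain ⟨q, hq⟩ := hc.dvd_of_ev_eq_zero hQ0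
  have hN := (place_monic hc.not_trivial (upsilon δ c)).1.ne_zero
  have hcen := Subring.mem_center_iff.mp (place_mem_center hc.upsilon_mem)
  have h2 : 1 * place δ (upsilon δ c) = q * (X - C c) * place δ (upsilon δ c) := by
    rw [one_mul, mul_assoc, hcen, ← mul_assoc, ← hq]
    exact hQ
  have h3 := congrArg (fun p => ev δ c p 1) (mul_right_cancel₀ hN h2)
  simp only [map_one, map_mul, Module.End.mul_apply, hev, map_zero, Module.End.one_apply] at h3
  exact one_ne_zero h3

/-- A deformation of `ev_c` along which `Z - υ(c)` becomes a polynomial with a simple zero. -/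
theorem Unramified.exists_deformation (hc : Unramified δ c) :
    ∃ (Φ : OrePoly δ →+* Polynomial (Module.End δ.constants K)) (q : Polynomial δ.constants),
      (∀ a, Φ (C a) = Polynomial.C (ev δ c (C a))) ∧ (∀ P, (Φ P).coeff 0 = ev δ c P) ∧
      Φ (place δ (upsilon δ c)) = q.map (algebraMap δ.constants (Module.End δ.constants K)) ∧
      q.coeff 0 = 0 ∧ q.coeff 1 ≠ 0 := by
  obtain ⟨Q, hQ, hQ0⟩ := hc.exists_cofactor_X_sub
  obtain ⟨h, hh⟩ : ∃ h, ev δ c Q h ≠ 0 := by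
    by_contra hcon
    push Not at hcon
    exact hQ0 (LinearMap.ext hcon)
  -- v moves past scalars exactly through θ, so adding v t to the image of X preserves the Ore
  -- relation. Choosing h outside the kernel of ev_c(Q) will give the simple zero.
  set v : Module.End δ.constants K := ev δ c (C h) * thetaEnd δ with hv
  have hvb : ∀ b, v * ev δ c (C b) = ev δ c (C (θ b)) * v := fun b => by
    ext x
    simp only [hv, Module.End.mul_apply, ev_C]
    change h * θ (b * x) = θ b * (h * θ x)
    rw [map_mul]; ring
  obtain ⟨Φ, hΦC, hΦX⟩ := exists_lift (δ := δ) (Polynomial.C.comp ((ev δ c).comp C))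
    (Polynomial.C (ev δ c X) + Polynomial.C v * Polynomial.X) (fun a => by
      simp only [RingHom.comp_apply]
      rw [add_mul, mul_assoc, Polynomial.X_mul_C, ← mul_assoc, ← Polynomial.C_mul,
        ← Polynomial.C_mul, ← map_mul, X_mul_C, hvb, map_add, map_mul, Polynomial.C_add,
        Polynomial.C_mul, Polynomial.C_mul, mul_add, mul_assoc (Polynomial.C _)]
      abel)
  have hΦ0 : ∀ P, (Φ P).coeff 0 = ev δ c P := by
    have : (Polynomial.constantCoeff (R := Module.End δ.constants K)).comp Φ = ev δ c :=
      ringHom_ext (fun a => by simp [hΦC]) (by simp [hΦX])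
    exact fun P => RingHom.congr_fun this P
  set w := Φ (place δ (upsilon δ c)) with hw
  have hcen := Subring.mem_center_iff.mp (place_mem_center hc.upsilon_mem)
  have hwC : ∀ n a, w.coeff n * ev δ c (C a) = ev δ c (C a) * w.coeff n := fun n a => by
    have := congrArg (fun p => (Φ p).coeff n) (hcen (C a))
    simp only [map_mul, hΦC, RingHom.comp_apply, Polynomial.coeff_C_mul,
      Polynomial.coeff_mul_C] at this
    exact this.symm
  have hwX : w * Φ X = Φ X * w := by
    rw [hw, ← map_mul, ← map_mul, hcen]
  -- Each coefficient of w commutes with scalars, so it is a scalar, and it lies in F as soon as it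
  -- commutes with u = ev_c(X). The coefficient of tⁿ⁺¹ in w Φ(X) = Φ(X) w reads w_{n+1} u + w_n v =
  -- u w_{n+1} + v w_n; when w_n is in F, the terms in v cancel.
  have hF : ∀ n, w.coeff n ∈ (algebraMap δ.constants (Module.End δ.constants K)).range := by
    have hstep : ∀ n, w.coeff n * ev δ c X = ev δ c X * w.coeff n →
        w.coeff n ∈ (algebraMap δ.constants (Module.End δ.constants K)).range := by
      intro n hn
      have hl := eq_ev_C_of_comm c (hwC n)
      set l := w.coeff n 1
      have hmem : l ∈ δ.constants := hc.mem_constants fun x => by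
        have := LinearMap.congr_fun hn x
        rw [hl, Module.End.mul_apply, Module.End.mul_apply, ev_C, ev_C, ev_X] at this
        exact this.symm
      refine ⟨⟨l, hmem⟩, ?_⟩
      rw [hl]
      ext x
      rw [ev_C]; rfl
    intro n
    induction n with
    | zero =>
      refine hstep 0 ?_
      rw [hw, hΦ0, ← map_mul, ← map_mul, hcen]
    | succ n ih =>
      refine hstep (n + 1) ?_
      obtain ⟨l, hl⟩ := ih
      have := congrArg (fun p => Polynomial.coeff p (n + 1)) hwX
      simp only [hΦX, mul_add, add_mul, Polynomial.coeff_add, ← mul_assoc,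
        Polynomial.coeff_mul_X, Polynomial.coeff_mul_C, Polynomial.coeff_C_mul] at this
      rw [mul_assoc (Polynomial.C v), Polynomial.X_mul, Polynomial.coeff_C_mul,
        Polynomial.coeff_mul_X, ← hl, Algebra.commutes] at this
      exact add_right_cancel this
  obtain ⟨q, hq⟩ := (Polynomial.mem_lifts w).mp ((Polynomial.lifts_iff_coeff_lifts w).mpr hF)
  have hinj : Function.Injective (algebraMap δ.constants (Module.End δ.constants K)) :=
    RingHom.injective _
  refine ⟨Φ, q, hΦC, hΦ0, hq.symm, hinj ?_, fun h1 => ?_⟩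
  · rw [← Polynomial.coeff_map, hq, hw, hΦ0, ev_place, map_zero]
  · have h2 : w.coeff 1 = 0 := by rw [← hq, Polynomial.coeff_map, h1, map_zero]
    have hlin : Φ (X - C c) = Polynomial.C (ev δ c (X - C c)) + Polynomial.C v * Polynomial.X := by
      rw [map_sub, hΦX, hΦC, map_sub, Polynomial.C_sub]
      simp only [RingHom.comp_apply]
      abel
    have hev : ev δ c (X - C c) 1 = 0 := by
      rw [map_sub, LinearMap.sub_apply, ev_X, pseudoEnd_apply, ev_C, δ.map_one_eq, map_one]
      ring
    have hv1 : v 1 = h := by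
      rw [hv, Module.End.mul_apply, ev_C]
      change h * θ 1 = h
      rw [map_one, mul_one]
    -- The linear coefficient of Φ(Q)Φ(X - c), applied to 1, is ev_c(Q)(h), because X - c kills 1
    -- and v(1) = h.
    rw [hw, hQ, map_mul, hlin, mul_add, ← mul_assoc, Polynomial.coeff_add, Polynomial.coeff_mul_C,
      Polynomial.coeff_mul_X, Polynomial.coeff_mul_C, hΦ0] at h2
    have h3 := LinearMap.congr_fun h2 1
    rw [LinearMap.add_apply, Module.End.mul_apply, Module.End.mul_apply, hev, hv1, map_zero,
      zero_add] at h3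
    exact hh h3

/-- A lift of `ev_c` to power series under which `Z - υ(c)` becomes the variable. -/
theorem Unramified.exists_powerSeries_lift (hc : Unramified δ c) :
    ∃ Ψ : OrePoly δ →+* PowerSeries (Module.End δ.constants K),
      (∀ a, Ψ (C a) = PowerSeries.C (ev δ c (C a))) ∧
      Ψ (place δ (upsilon δ c)) = PowerSeries.X ∧
      ∀ P, PowerSeries.constantCoeff (Ψ P) = ev δ c P := by
  obtain ⟨Φ, q, hΦC, hΦ0, hΦN, hq0, hq1⟩ := hc.exists_deformation
  obtain ⟨τ, hτ0, hτ⟩ := PowerSeries.exists_aeval_eq_X q hq0 hq1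
  set alg := algebraMap δ.constants (Module.End δ.constants K)
  -- Substitution t = τ(T). It is multiplicative although the coefficients do not commute, because τ
  -- has coefficients in F, which is central in End_F(K).
  let f := Polynomial.eval₂RingHom' (PowerSeries.C (R := Module.End δ.constants K))
    (PowerSeries.map alg τ) (fun e => by
      refine PowerSeries.ext fun n => ?_
      rw [PowerSeries.coeff_C_mul, PowerSeries.coeff_mul_C, PowerSeries.coeff_map]
      exact (Algebra.commutes _ _).symm)
  have hf0 : ∀ p, PowerSeries.constantCoeff (f p) = p.coeff 0 := by
    have : (PowerSeries.constantCoeff (R := Module.End δ.constants K)).comp f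
        = Polynomial.constantCoeff :=
      Polynomial.ringHom_ext
        (fun a => by
          change PowerSeries.constantCoeff (Polynomial.eval₂ _ _ _) = _
          rw [Polynomial.eval₂_C, PowerSeries.constantCoeff_C, Polynomial.constantCoeff_apply,
            Polynomial.coeff_C_zero])
        (by
          change PowerSeries.constantCoeff (Polynomial.eval₂ _ _ _) = _
          rw [Polynomial.eval₂_X, ← PowerSeries.coeff_zero_eq_constantCoeff_apply,
            PowerSeries.coeff_map, PowerSeries.coeff_zero_eq_constantCoeff_apply, hτ0, map_zero,
            Polynomial.constantCoeff_apply, Polynomial.coeff_X_zero])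
    exact fun p => RingHom.congr_fun this p
  refine ⟨f.comp Φ, fun a => ?_, ?_, fun P => ?_⟩
  · rw [RingHom.comp_apply, hΦC]; exact Polynomial.eval₂_C _ _
  · rw [RingHom.comp_apply, hΦN]
    change Polynomial.eval₂ _ _ _ = _
    rw [Polynomial.eval₂_map, ← PowerSeries.map_X alg, ← hτ, Polynomial.aeval_def,
      Polynomial.hom_eval₂]
    congr 1
    ext1 a
    change _ = PowerSeries.map alg (PowerSeries.C a)
    rw [PowerSeries.map_C]; rfl
  · rw [RingHom.comp_apply, hf0, hΦ0]

end OrePoly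

/-! ### From lifts to power series to Taylor expansions of fractions -/

/-- A power series whose first nonzero coefficient is a unit is invertible as a Laurent series. -/
theorem PowerSeries.isUnit_ofPowerSeries {R : Type*} [Ring R] {f : PowerSeries R} {n : ℕ}
    (h0 : ∀ j < n, PowerSeries.coeff j f = 0) (hn : IsUnit (PowerSeries.coeff n f)) :
    IsUnit (HahnSeries.ofPowerSeries ℤ R f) := by
  set g : PowerSeries R := PowerSeries.mk fun j => PowerSeries.coeff (j + n) f with hg
  have hf : f = PowerSeries.X ^ n * g := by
    ext j
    rw [PowerSeries.coeff_X_pow_mul']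
    split_ifs with h
    · rw [hg, PowerSeries.coeff_mk, Nat.sub_add_cancel h]
    · exact h0 j (by omega)
  obtain ⟨u, hu⟩ := hn
  have hgu : PowerSeries.constantCoeff g = u := by
    rw [← PowerSeries.coeff_zero_eq_constantCoeff_apply, hg, PowerSeries.coeff_mk, zero_add, hu]
  rw [hf, map_mul, HahnSeries.ofPowerSeries_X_pow]
  refine IsUnit.mul ⟨⟨HahnSeries.single (n : ℤ) 1, HahnSeries.single (-n : ℤ) 1, ?_, ?_⟩, rfl⟩
    (IsUnit.map _ ⟨⟨g, PowerSeries.invOfUnit g u, PowerSeries.mul_invOfUnit g u hgu,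
      PowerSeries.invOfUnit_mul g u hgu⟩, rfl⟩)
  · rw [HahnSeries.single_mul_single, add_neg_cancel, mul_one]; rfl
  · rw [HahnSeries.single_mul_single, neg_add_cancel, mul_one]; rfl

namespace OrePoly

open Module

variable {K : Type*} [Field K] {θ : K →+* K} {δ : SkewDerivation θ} {z : K}

/-- Since Nʳ is central, its multiples already form a two-sided ideal. -/
theorem proj_eq_zero_iff (hz : place δ z ∈ Subring.center (OrePoly δ)) (r : ℕ) (p : OrePoly δ) :
    proj δ z r p = 0 ↔ ∃ q, p = place δ z ^ r * q := by
  have hcen := Subring.mem_center_iff.mp (pow_mem hz r)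
  have h1 : proj δ z r p = 0 ↔ p ∈ placeIdeal δ z r := by
    rw [TwoSidedIdeal.mem_iff, ← map_zero (proj δ z r)]
    exact (RingCon.eq _)
  rw [h1]
  constructor
  · let J : TwoSidedIdeal (OrePoly δ) := TwoSidedIdeal.mk' {p | ∃ q, p = place δ z ^ r * q}
      ⟨0, by rw [mul_zero]⟩
      (by rintro _ _ ⟨a, rfl⟩ ⟨b, rfl⟩; exact ⟨a + b, by rw [mul_add]⟩)
      (by rintro _ ⟨a, rfl⟩; exact ⟨-a, by rw [mul_neg]⟩)
      (by rintro x _ ⟨a, rfl⟩; exact ⟨x * a, by rw [← mul_assoc, hcen, mul_assoc]⟩)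
      (by rintro _ y ⟨a, rfl⟩; exact ⟨a * y, by rw [mul_assoc]⟩)
    have hmem : ∀ x, x ∈ J ↔ ∃ q, x = place δ z ^ r * q := fun x =>
      TwoSidedIdeal.mem_mk' {p | ∃ q, p = place δ z ^ r * q} _ _ _ _ _ x
    have hJ : placeIdeal δ z r ≤ J := by
      rw [placeIdeal, TwoSidedIdeal.span_le]
      rintro _ rfl
      exact (hmem _).mpr ⟨1, by rw [mul_one]⟩
    exact fun h => (hmem p).mp (hJ h)
  · rintro ⟨q, rfl⟩
    exact TwoSidedIdeal.mul_mem_right _ _ _ (TwoSidedIdeal.subset_span rfl)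

/-- A ring homomorphism from the Ore polynomials to power series over `A⁺ / N A⁺`, extending the
projection and mapping `N` to the variable. -/
structure IsTaylorLift (δ : SkewDerivation θ) (z : K)
    (Ψ : OrePoly δ →+* PowerSeries (ResidueRing δ z)) : Prop where
  center : place δ z ∈ Subring.center (OrePoly δ)
  map_C : ∀ a, Ψ (C a) = PowerSeries.C (proj δ z 1 (C a))
  map_place : Ψ (place δ z) = PowerSeries.X
  constantCoeff_eq : ∀ P, PowerSeries.constantCoeff (Ψ P) = proj δ z 1 P

namespace IsTaylorLift

variable {Ψ : OrePoly δ →+* PowerSeries (ResidueRing δ z)}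

/-- The N-adic and T-adic filtrations match: a vanishing constant coefficient lets one factor N be
split off, and Ψ turns it into T. -/
theorem coeff_eq_zero_iff (h : IsTaylorLift δ z Ψ) (r : ℕ) :
    ∀ P, (∀ j < r, PowerSeries.coeff j (Ψ P) = 0) ↔ proj δ z r P = 0 := by
  intro P
  rw [proj_eq_zero_iff h.center]
  constructor
  · induction r generalizing P with
    | zero => exact fun _ => ⟨P, by rw [pow_zero, one_mul]⟩
    | succ r ih =>
      intro hP
      have h0 := hP 0 (Nat.succ_pos r)
      rw [PowerSeries.coeff_zero_eq_constantCoeff_apply, h.constantCoeff_eq,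
        proj_eq_zero_iff h.center] at h0
      obtain ⟨q, rfl⟩ := h0
      obtain ⟨q', rfl⟩ := ih q fun j hj => by
        have := hP (j + 1) (Nat.succ_lt_succ hj)
        rwa [pow_one, map_mul, h.map_place, PowerSeries.coeff_succ_X_mul] at this
      exact ⟨q', by rw [← mul_assoc, ← pow_add, add_comm]⟩
  · rintro ⟨q, rfl⟩ j hj
    rw [map_mul, map_pow, h.map_place, PowerSeries.coeff_X_pow_mul', if_neg (by omega)]

theorem coeff_eq_iff (h : IsTaylorLift δ z Ψ) (r : ℕ) (P Q : OrePoly δ) :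
    (∀ j < r, PowerSeries.coeff j (Ψ P) = PowerSeries.coeff j (Ψ Q)) ↔
      proj δ z r P = proj δ z r Q := by
  rw [← sub_eq_zero, ← map_sub, ← h.coeff_eq_zero_iff]
  refine forall₂_congr fun j _ => ?_
  rw [map_sub, map_sub, sub_eq_zero]

theorem proj_eq_of_le (x : completion δ z) {P : OrePoly δ} {r n : ℕ} (hn : n ≤ r)
    (hP : proj δ z r P = x.1 r) : proj δ z n P = x.1 n := by
  induction r, hn using Nat.le_induction with
  | base => exact hP
  | succ r hr ih => exact ih (by rw [← x.2 r, ← hP]; rfl)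

/-- The coefficients of the series attached to an element of the completion. -/
noncomputable def extendFun (Ψ : OrePoly δ →+* PowerSeries (ResidueRing δ z))
    (x : completion δ z) : PowerSeries (ResidueRing δ z) :=
  PowerSeries.mk fun n =>
    PowerSeries.coeff n (Ψ (proj_surjective z (n + 1) (x.1 (n + 1))).choose)

/-- The coefficient of Tⁿ depends only on the class modulo Nⁿ⁺¹, so any representative at a level
beyond n may be used. -/
theorem coeff_extendFun (h : IsTaylorLift δ z Ψ) (x : completion δ z) {P : OrePoly δ} {r n : ℕ}
    (hn : n < r) (hP : proj δ z r P = x.1 r) :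
    PowerSeries.coeff n (extendFun Ψ x) = PowerSeries.coeff n (Ψ P) := by
  rw [extendFun, PowerSeries.coeff_mk]
  refine (h.coeff_eq_iff (n + 1) _ _).mpr ?_ n (Nat.lt_succ_self n)
  rw [(proj_surjective z (n + 1) (x.1 (n + 1))).choose_spec, proj_eq_of_le x hn hP]

/-- T-adic density of the image: match the constant coefficient, divide the difference by T, and
repeat. -/
theorem exists_coeff_eq (h : IsTaylorLift δ z Ψ) (r : ℕ) (f : PowerSeries (ResidueRing δ z)) :
    ∃ P, ∀ j < r, PowerSeries.coeff j (Ψ P) = PowerSeries.coeff j f := by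
  induction r generalizing f with
  | zero => exact ⟨0, fun j hj => absurd hj (Nat.not_lt_zero j)⟩
  | succ r ih =>
    obtain ⟨P₀, hP₀⟩ := proj_surjective z 1 (PowerSeries.constantCoeff f)
    obtain ⟨P, hP⟩ := ih (PowerSeries.mk fun j => PowerSeries.coeff (j + 1) (f - Ψ P₀))
    refine ⟨P₀ + place δ z * P, fun j hj => ?_⟩
    rw [map_add, map_mul, h.map_place, map_add]
    cases j with
    | zero =>
      rw [PowerSeries.coeff_zero_X_mul, add_zero, PowerSeries.coeff_zero_eq_constantCoeff_apply,
        PowerSeries.coeff_zero_eq_constantCoeff_apply, h.constantCoeff_eq, hP₀]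
    | succ j =>
      rw [PowerSeries.coeff_succ_X_mul, hP j (by omega), PowerSeries.coeff_mk, map_sub,
        add_sub_cancel]

/-- The extension to the completion. -/
noncomputable def extend (h : IsTaylorLift δ z Ψ) :
    completion δ z →+* PowerSeries (ResidueRing δ z) where
  toFun := extendFun Ψ
  map_one' := PowerSeries.ext fun n => by
    rw [h.coeff_extendFun 1 (P := 1) (Nat.lt_succ_self n) (map_one _), map_one]
  map_zero' := PowerSeries.ext fun n => by
    rw [h.coeff_extendFun 0 (P := 0) (Nat.lt_succ_self n) (map_zero _), map_zero]
  map_add' x y := PowerSeries.ext fun n => by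
    obtain ⟨P, hP⟩ := proj_surjective z (n + 1) (x.1 (n + 1))
    obtain ⟨Q, hQ⟩ := proj_surjective z (n + 1) (y.1 (n + 1))
    rw [map_add, h.coeff_extendFun x (Nat.lt_succ_self n) hP,
      h.coeff_extendFun y (Nat.lt_succ_self n) hQ, ← map_add, ← map_add Ψ]
    exact h.coeff_extendFun (x + y) (Nat.lt_succ_self n) (by rw [map_add, hP, hQ]; rfl)
  map_mul' x y := PowerSeries.ext fun n => by
    obtain ⟨P, hP⟩ := proj_surjective z (n + 1) (x.1 (n + 1))
    obtain ⟨Q, hQ⟩ := proj_surjective z (n + 1) (y.1 (n + 1))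
    rw [h.coeff_extendFun (x * y) (P := P * Q) (Nat.lt_succ_self n)
      (by rw [map_mul, hP, hQ]; rfl), map_mul, PowerSeries.coeff_mul, PowerSeries.coeff_mul]
    refine Finset.sum_congr rfl fun p hp => ?_
    have := Finset.HasAntidiagonal.mem_antidiagonal.mp hp
    rw [h.coeff_extendFun x (by omega) hP, h.coeff_extendFun y (by omega) hQ]

theorem extend_bijective (h : IsTaylorLift δ z Ψ) : Function.Bijective h.extend := by
  refine ⟨?_, fun f => ?_⟩
  · rw [injective_iff_map_eq_zero]
    intro x hx
    refine Subtype.ext (funext fun r => ?_)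
    obtain ⟨P, hP⟩ := proj_surjective z r (x.1 r)
    change x.1 r = 0
    rw [← hP, ← h.coeff_eq_zero_iff]
    intro j hj
    rw [← h.coeff_extendFun x hj hP]
    change PowerSeries.coeff j (h.extend x) = 0
    rw [hx, map_zero]
  -- Approximations of f modulo Tʳ have compatible classes modulo Nʳ, hence define a point of the
  -- completion.
  · choose P hP using fun r => h.exists_coeff_eq r f
    refine ⟨⟨fun r => proj δ z r (P r), fun r => ?_⟩, PowerSeries.ext fun n => ?_⟩
    · change proj δ z r (P (r + 1)) = proj δ z r (P r)
      exact (h.coeff_eq_iff r _ _).mp fun j hj => by rw [hP _ j (by omega), hP _ j hj]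
    · exact (h.coeff_extendFun _ (Nat.lt_succ_self n) rfl).trans (hP _ n (Nat.lt_succ_self n))

theorem extend_toCompletion (h : IsTaylorLift δ z Ψ) (P : OrePoly δ) :
    h.extend (toCompletion δ z P) = Ψ P :=
  PowerSeries.ext fun n => h.coeff_extendFun (toCompletion δ z P) (Nat.lt_succ_self n) rfl

/-- The admissible isomorphism attached to a lift. -/
noncomputable def equiv (h : IsTaylorLift δ z Ψ) :
    completion δ z ≃+* PowerSeries (ResidueRing δ z) :=
  RingEquiv.ofBijective h.extend h.extend_bijective

theorem isAdmissible_equiv (h : IsTaylorLift δ z Ψ) : IsAdmissible δ z h.equiv where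
  map_C a := (h.extend_toCompletion _).trans (h.map_C a)
  map_place := (h.extend_toCompletion _).trans h.map_place
  constantCoeff_eq x := by
    obtain ⟨P, hP⟩ := proj_surjective z 1 (x.1 1)
    rw [← PowerSeries.coeff_zero_eq_constantCoeff_apply]
    refine (h.coeff_extendFun x Nat.one_pos hP).trans ?_
    rw [PowerSeries.coeff_zero_eq_constantCoeff_apply, h.constantCoeff_eq, hP]

end IsTaylorLift

/-- Every nonzero Ore polynomial has a nonzero left multiple of the form `∑ aⱼ Nʲ`. -/
theorem exists_mul_eq_sum (N : OrePoly δ) {P : OrePoly δ} (hP : P ≠ 0) :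
    ∃ (d : ℕ) (a : Fin d → K) (Q : OrePoly δ), a ≠ 0 ∧
      Q * P = ∑ j, a j • N ^ (j : ℕ) := by
  obtain ⟨d, hd⟩ := exists_degree_eq hP
  let L : OrePoly δ →ₗ[K] OrePoly δ :=
    { toFun := fun Q => Q * P
      map_add' := fun Q R => add_mul Q R P
      map_smul' := fun a Q => by
        rw [RingHom.id_apply, ← C_mul, ← C_mul, mul_assoc] }
  let π : degreeLT δ d →ₗ[K] (OrePoly δ ⧸ LinearMap.range L) :=
    (LinearMap.range L).mkQ.domRestrict _
  -- Right division by P bounds the dimension over K of A⁺/A⁺P by d = deg P, so the d + 1 powers 1,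
  -- N, …, Nᵈ are dependent there.
  have hπ : Function.Surjective π := by
    intro x
    obtain ⟨A, rfl⟩ := Submodule.mkQ_surjective _ x
    obtain ⟨R, hR, Q, rfl⟩ := exists_rightDiv A hP
    rw [hd] at hR
    have hQ : (LinearMap.range L).mkQ (Q * P) = 0 :=
      (Submodule.Quotient.mk_eq_zero (LinearMap.range L)).mpr ⟨Q, rfl⟩
    refine ⟨⟨R, hR⟩, ?_⟩
    rw [map_add, hQ, zero_add]
    rfl
  have hfin : Module.Finite K (OrePoly δ ⧸ LinearMap.range L) := Module.Finite.of_surjective π hπ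
  have hle : finrank K (OrePoly δ ⧸ LinearMap.range L) ≤ d := by
    rw [← finrank_degreeLT δ d]
    exact LinearMap.finrank_le_finrank_of_surjective hπ
  have hker : LinearMap.ker ((LinearMap.range L).mkQ.comp
      (Fintype.linearCombination K fun j : Fin (d + 1) => N ^ (j : ℕ))) ≠ ⊥ :=
    LinearMap.ker_ne_bot_of_finrank_lt (by rw [finrank_fin_fun]; omega)
  obtain ⟨a, ha, ha0⟩ := Submodule.exists_mem_ne_zero_of_ne_bot hker
  obtain ⟨Q, hQ⟩ := (Submodule.Quotient.mk_eq_zero _).mp ha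
  exact ⟨d + 1, a, Q, ha0, hQ⟩

/-- Some left multiple QP = ∑ a_j Nʲ is sent to ∑ a_j Tʲ, whose lowest nonzero coefficient comes
from K and is a unit; so Ψ(P) has a left inverse. Applying this also to Q shows that Ψ(Q) is
invertible on both sides, and then so is Ψ(P). -/
theorem IsTaylorLift.isUnit [Nontrivial (ResidueRing δ z)]
    {Ψ : OrePoly δ →+* PowerSeries (ResidueRing δ z)} (h : IsTaylorLift δ z Ψ) {P : OrePoly δ}
    (hP : P ≠ 0) : IsUnit (HahnSeries.ofPowerSeries ℤ _ (Ψ P)) := by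
  classical
  have key : ∀ P : OrePoly δ, P ≠ 0 → ∃ Q : OrePoly δ, Q ≠ 0 ∧
      IsUnit (HahnSeries.ofPowerSeries ℤ _ (Ψ Q) * HahnSeries.ofPowerSeries ℤ _ (Ψ P)) := by
    intro P hP
    obtain ⟨d, a, Q, ha, hQ⟩ := exists_mul_eq_sum (place δ z) hP
    have hcoeff : ∀ n, PowerSeries.coeff n (Ψ (Q * P)) =
        if hn : n < d then proj δ z 1 (C (a ⟨n, hn⟩)) else 0 := by
      intro n
      rw [hQ, map_sum, map_sum]
      have : ∀ j : Fin d, PowerSeries.coeff n (Ψ (a j • place δ z ^ (j : ℕ)))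
          = if n = j then proj δ z 1 (C (a j)) else 0 := fun j => by
        rw [← C_mul, map_mul, h.map_C, map_pow, h.map_place, PowerSeries.coeff_C_mul,
          PowerSeries.coeff_X_pow, mul_ite, mul_one, mul_zero]
      simp only [this]
      split_ifs with hn
      · rw [Finset.sum_eq_single ⟨n, hn⟩ (fun j _ hj => if_neg fun h => hj (Fin.ext h.symm))
          (fun h => absurd (Finset.mem_univ _) h), if_pos rfl]
      · exact Finset.sum_eq_zero fun j _ => if_neg (by rintro rfl; exact hn j.2)
    have hex : ∃ n, ∃ hn : n < d, a ⟨n, hn⟩ ≠ 0 := by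
      obtain ⟨j, hj⟩ := Function.ne_iff.mp ha
      exact ⟨j, j.2, hj⟩
    obtain ⟨hn, hna⟩ := Nat.find_spec hex
    have hu : IsUnit (HahnSeries.ofPowerSeries ℤ _ (Ψ (Q * P))) := by
      refine PowerSeries.isUnit_ofPowerSeries (n := Nat.find hex) (fun j hj => ?_) ?_
      · rw [hcoeff]
        split_ifs with hjd
        · have := Nat.find_min hex hj
          push Not at this
          rw [this hjd, map_zero, map_zero]
        · rfl
      · rw [hcoeff, dif_pos hn]
        exact (hna.isUnit.map C).map _
    refine ⟨Q, ?_, by rwa [map_mul, map_mul] at hu⟩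
    rintro rfl
    rw [zero_mul, map_zero, map_zero] at hu
    exact not_isUnit_zero hu
  obtain ⟨Q, hQ, hQP⟩ := key P hP
  obtain ⟨R, -, hRQ⟩ := key Q hQ
  have hQu : IsUnit (HahnSeries.ofPowerSeries ℤ _ (Ψ Q)) := by
    obtain ⟨u, hu⟩ := hQP
    obtain ⟨v, hv⟩ := hRQ
    exact isUnit_iff_exists_and_exists.mpr
      ⟨⟨_, by rw [← mul_assoc, ← hu, Units.mul_inv]⟩, ⟨_, by rw [mul_assoc, ← hv, Units.inv_mul]⟩⟩
  obtain ⟨v, hv⟩ := hQu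
  rw [← hv, Units.isUnit_units_mul] at hQP
  exact hQP

/-- Nonzero Ore polynomials become invertible Laurent series, so the universal property of Ore
localization extends the map to fractions. -/
theorem IsTaylorLift.exists_isTaylorExpansion [Nontrivial (ResidueRing δ z)]
    {Ψ : OrePoly δ →+* PowerSeries (ResidueRing δ z)} (h : IsTaylorLift δ z Ψ) :
    ∃ TS : FracField δ →+* LaurentSeries (ResidueRing δ z), IsTaylorExpansion δ z TS := by
  let f : OrePoly δ →+* LaurentSeries (ResidueRing δ z) :=
    (HahnSeries.ofPowerSeries ℤ (ResidueRing δ z)).comp Ψ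
  have hu : ∀ s : nonZeroDivisors (OrePoly δ), IsUnit (f s) := fun s =>
    h.isUnit (nonZeroDivisors.ne_zero s.2)
  let fS : nonZeroDivisors (OrePoly δ) →* (LaurentSeries (ResidueRing δ z))ˣ :=
    IsUnit.liftRight (f.toMonoidHom.comp (nonZeroDivisors (OrePoly δ)).subtype) hu
  have hfS : ∀ s : nonZeroDivisors (OrePoly δ), f s = fS s := fun s =>
    (IsUnit.coe_liftRight (f.toMonoidHom.comp (nonZeroDivisors (OrePoly δ)).subtype) hu s).symm
  refine ⟨OreLocalization.universalHom f fS hfS, h.equiv, h.isAdmissible_equiv, fun P => ?_⟩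
  refine (OreLocalization.universalHom_commutes f fS hfS).trans ?_
  exact congrArg (HahnSeries.ofPowerSeries ℤ _) (h.extend_toCompletion P).symm

theorem Unramified.exists_isTaylorExpansion [FiniteDimensional δ.constants K] {c : K}
    (hc : Unramified δ c) :
    ∃ TS : FracField δ →+* LaurentSeries (ResidueRing δ (upsilon δ c)),
      IsTaylorExpansion δ (upsilon δ c) TS := by
  obtain ⟨Ψ, hC, hN, h0⟩ := hc.exists_powerSeries_lift
  let e : ResidueRing δ (upsilon δ c) ≃+* Module.End δ.constants K :=
    RingEquiv.ofBijective (evRes δ c) hc.evRes_bijective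
  have he : ∀ P, e.symm (ev δ c P) = proj δ (upsilon δ c) 1 P := fun P =>
    e.symm_apply_apply (proj δ (upsilon δ c) 1 P)
  have : Nontrivial (ResidueRing δ (upsilon δ c)) := e.toEquiv.nontrivial
  refine IsTaylorLift.exists_isTaylorExpansion
    (Ψ := (PowerSeries.map (e.symm : Module.End δ.constants K →+* _)).comp Ψ)
    ⟨place_mem_center hc.upsilon_mem, fun a => ?_, ?_, fun P => ?_⟩
  · rw [RingHom.comp_apply, hC, PowerSeries.map_C]
    exact congrArg _ (he _)
  · rw [RingHom.comp_apply, hN, PowerSeries.map_X]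
  · rw [RingHom.comp_apply, ← PowerSeries.coeff_zero_eq_constantCoeff_apply, PowerSeries.coeff_map,
      PowerSeries.coeff_zero_eq_constantCoeff_apply, h0]
    exact he P

end OrePoly

/-! ### Transfer along the isomorphisms τ_i and the main theorem -/

namespace OrePoly

open Module

variable {K : Type*} [Field K] {θ : K →+* K} {δ : SkewDerivation θ}

theorem descend_mk {F M : Type*} [Field F] [Module F K] [AddCommGroup M] [Module F M]
    {V : Submodule F K} {f : K →ₗ[F] M} (h : V ≤ LinearMap.ker f) (x : K) :
    descend V f (Submodule.Quotient.mk x) = f x := by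
  rw [descend, dif_pos h]
  exact V.liftQ_apply f x

section Transfer

variable [FiniteDimensional δ.constants K] {m k : ℕ} {c : Fin m → K}
  {V : Fin m → Submodule δ.constants K} {D : OrePoly δ}
  {TS : ∀ i, FracField δ →+* LaurentSeries (ResidueRing δ (upsilon δ (c i)))}

theorem coe_tau_mk {i : Fin m} (h : V i ≤ LinearMap.ker (tauTilde k c V D TS i)) (x : K) :
    (tau k c V D TS i (Submodule.Quotient.mk x) : K) = tauTilde k c V D TS i x :=
  congrArg Subtype.val (descend_mk (f := (tauTilde k c V D TS i).rangeRestrict)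
    (by rwa [LinearMap.ker_rangeRestrict]) x)

theorem tau_bijective (h : ∀ i, LinearMap.ker (tauTilde k c V D TS i) = V i) (i : Fin m) :
    Function.Bijective (tau k c V D TS i) := by
  constructor
  · rw [injective_iff_map_eq_zero]
    intro x hx
    obtain ⟨x, rfl⟩ := Submodule.Quotient.mk_surjective _ x
    rw [Submodule.Quotient.mk_eq_zero, ← h i, LinearMap.mem_ker, ← coe_tau_mk (h i).ge, hx,
      Submodule.coe_zero]
  · rintro ⟨_, x, rfl⟩
    exact ⟨Submodule.Quotient.mk x, Subtype.ext (coe_tau_mk (h i).ge x)⟩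

theorem Psi_bijective (h : ∀ i, Function.Bijective (tau k c V D TS i)) :
    Function.Bijective (Psi k c V D TS) := by
  constructor
  · intro φ ψ hφ
    refine funext fun i => LinearMap.ext fun y => ?_
    obtain ⟨x, rfl⟩ := (h i).2 y
    exact LinearMap.congr_fun (congrFun hφ i) x
  · intro ψ
    refine ⟨fun i => (ψ i).comp (LinearEquiv.ofBijective _ (h i)).symm.toLinearMap,
      funext fun i => LinearMap.ext fun x => ?_⟩
    exact congrArg (ψ i) ((LinearEquiv.ofBijective _ (h i)).symm_apply_apply x)

theorem sumRankWeight_Psi (h : ∀ i, Function.Bijective (tau k c V D TS i))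
    (φ : ∀ i, goppaW k c V D TS i →ₗ[δ.constants] K) :
    sumRankWeight (Psi k c V D TS φ) = sumRankWeight φ := by
  refine Finset.sum_congr rfl fun i _ => ?_
  exact congrArg (fun W : Submodule δ.constants K => finrank δ.constants W)
    (LinearMap.range_comp_of_range_eq_top (φ i) (LinearMap.range_eq_top.mpr (h i).2))

end Transfer

end OrePoly

theorem mainTheorem2 {K : Type*} [Field K] (θ : K →+* K) (δ : SkewDerivation θ)
    [FiniteDimensional δ.constants K]
    (hne : ¬ (θ = RingHom.id K ∧ ∀ x : K, δ x = 0))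
    {m : ℕ} (hm : 0 < m) (c : Fin m → K) (hc : ∀ i, OrePoly.Unramified δ (c i))
    (hυ : Function.Injective fun i => OrePoly.upsilon δ (c i))
    (V : Fin m → Submodule δ.constants K)
    (k : ℕ) (hk : 0 < k) (hkn : k < ∑ i, Module.finrank δ.constants (K ⧸ V i)) :
    (∀ i, ∃ TS : OrePoly.FracField δ →+*
        LaurentSeries (OrePoly.ResidueRing δ (OrePoly.upsilon δ (c i))),
      OrePoly.IsTaylorExpansion δ (OrePoly.upsilon δ (c i)) TS) ∧
    (∃! D : OrePoly δ, OrePoly.IsGoppaDenominator δ c V D) ∧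
    ∀ D : OrePoly δ, OrePoly.IsGoppaDenominator δ c V D →
    ∀ TS : ∀ i, OrePoly.FracField δ →+*
        LaurentSeries (OrePoly.ResidueRing δ (OrePoly.upsilon δ (c i))),
      (∀ i, OrePoly.IsTaylorExpansion δ (OrePoly.upsilon δ (c i)) (TS i)) →
      (∀ i, OrePoly.NoPole (TS i) (OrePoly.goppaPN k c V D i)) ∧
      (∀ i, LinearMap.ker (OrePoly.tauTilde k c V D TS i) = V i) ∧
      (∀ i, Function.Bijective (OrePoly.tau k c V D TS i)) ∧
      (∀ Q ∈ OrePoly.degreeLT δ k, ∀ i, V i ≤ LinearMap.ker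
        (OrePoly.evRes δ (c i)
          (OrePoly.sres (TS i) (OrePoly.toFrac δ Q * OrePoly.goppaP δ k V D)))) ∧
      Function.Bijective (OrePoly.Psi k c V D TS) ∧
      (∀ φ, OrePoly.sumRankWeight (OrePoly.Psi k c V D TS φ) = OrePoly.sumRankWeight φ) ∧
      (∀ φ ψ, OrePoly.sumRankDist (OrePoly.Psi k c V D TS φ) (OrePoly.Psi k c V D TS ψ)
        = OrePoly.sumRankDist φ ψ) ∧
      (((OrePoly.LRS δ k c (OrePoly.goppaW k c V D TS)).map (OrePoly.Psi k c V D TS) :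
          Submodule K (∀ i, (K ⧸ V i) →ₗ[δ.constants] K)) :
          Set (∀ i, (K ⧸ V i) →ₗ[δ.constants] K)) = OrePoly.LG k c V D TS ∧
      ∀ TS' : ∀ i, OrePoly.FracField δ →+*
          LaurentSeries (OrePoly.ResidueRing δ (OrePoly.upsilon δ (c i))),
        (∀ i, OrePoly.IsTaylorExpansion δ (OrePoly.upsilon δ (c i)) (TS' i)) →
        OrePoly.tauTilde k c V D TS' = OrePoly.tauTilde k c V D TS ∧
        OrePoly.LG k c V D TS' = OrePoly.LG k c V D TS := by
  refine ⟨fun i => (hc i).exists_isTaylorExpansion,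
    OrePoly.existsUnique_goppaDenominator hc hυ V, fun D hD TS hTS => ?_⟩
  choose v hker hv using hD.exists_value hc hυ k
  have htt : ∀ TS' : ∀ i, OrePoly.FracField δ →+*
      LaurentSeries (OrePoly.ResidueRing δ (OrePoly.upsilon δ (c i))),
      (∀ i, OrePoly.IsTaylorExpansion δ (OrePoly.upsilon δ (c i)) (TS' i)) →
      ∀ i, OrePoly.tauTilde k c V D TS' i = OrePoly.evRes δ (c i) (v i) := fun TS' h i => by
    rw [OrePoly.tauTilde, (hv i _ (h i)).2.1]
  -- The central identity ev(sres(QP)) = ev(Q) ∘ τ̃_i. It gives vanishing on V_i, independence of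
  -- the Taylor expansions and the comparison of the codes.
  have hsres : ∀ TS' : ∀ i, OrePoly.FracField δ →+*
      LaurentSeries (OrePoly.ResidueRing δ (OrePoly.upsilon δ (c i))),
      (∀ i, OrePoly.IsTaylorExpansion δ (OrePoly.upsilon δ (c i)) (TS' i)) →
      ∀ i Q, OrePoly.evRes δ (c i)
        (OrePoly.sres (TS' i) (OrePoly.toFrac δ Q * OrePoly.goppaP δ k V D))
          = OrePoly.ev δ (c i) Q * OrePoly.evRes δ (c i) (v i) := fun TS' h i Q => by
    rw [(hv i _ (h i)).2.2, map_mul, OrePoly.evRes_proj]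
  have hkert : ∀ i, LinearMap.ker (OrePoly.tauTilde k c V D TS i) = V i := fun i => by
    rw [htt TS hTS, hker]
  have htau := OrePoly.tau_bijective hkert
  have hle : ∀ i Q, V i ≤ LinearMap.ker (OrePoly.evRes δ (c i)
      (OrePoly.sres (TS i) (OrePoly.toFrac δ Q * OrePoly.goppaP δ k V D))) := fun i Q x hx => by
    rw [← hker i, LinearMap.mem_ker] at hx
    rw [LinearMap.mem_ker, hsres TS hTS, Module.End.mul_apply, hx, map_zero]
  refine ⟨fun i => (hv i _ (hTS i)).1, hkert, htau, fun Q _ i => hle i Q,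
    OrePoly.Psi_bijective htau, OrePoly.sumRankWeight_Psi htau, fun φ ψ => ?_, ?_,
    fun TS' hTS' => ⟨funext fun i => (htt TS' hTS' i).trans (htt TS hTS i).symm, ?_⟩⟩
  · rw [OrePoly.sumRankDist, ← map_sub, OrePoly.sumRankWeight_Psi htau]
    rfl
  -- Ψ sends the Reed-Solomon codeword of Q to the Goppa codeword of QP; this is checked after
  -- composition with K → K/V_i.
  · have hΨ : ∀ Q, OrePoly.Psi k c V D TS
        (OrePoly.evTuple δ c (OrePoly.goppaW k c V D TS) Q) =
        OrePoly.gamma c V TS (OrePoly.toFrac δ Q * OrePoly.goppaP δ k V D) := fun Q => by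
      refine funext fun i => Submodule.linearMap_qext _ (LinearMap.ext fun x => ?_)
      have h1 := OrePoly.coe_tau_mk (hkert i).ge x
      rw [LinearMap.comp_apply, LinearMap.comp_apply, Submodule.mkQ_apply, OrePoly.gamma,
        OrePoly.descend_mk (hle i Q), hsres TS hTS, ← htt TS hTS, Module.End.mul_apply, ← h1]
      rfl
    ext φ
    constructor
    · rintro ⟨_, ⟨Q, hQ, rfl⟩, rfl⟩
      exact ⟨_, ⟨Q, hQ, rfl⟩, (hΨ Q).symm⟩
    · rintro ⟨_, ⟨Q, hQ, rfl⟩, rfl⟩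
      exact ⟨_, ⟨Q, hQ, rfl⟩, hΨ Q⟩
  · refine Set.image_congr ?_
    rintro _ ⟨Q, hQ, rfl⟩
    funext i
    rw [OrePoly.gamma, OrePoly.gamma, hsres TS' hTS', hsres TS hTS]
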